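/- Let $(a_k)_{k\ge 1}$ be complex numbers with $a_1\neq 0$, let $\eta(s)=\sum_{k\ge1}a_kk^{-s}$ be the associated Dirichlet series, and suppose that there are real constants $\alpha,\beta$ with $0\le\alpha\le1$, and with $\beta=0$ if $\alpha=0$, such that the function $$\kappa_\eta(x)=\beta x^\alpha-\sum_{k\le x}a_k\qquad(x>0)$$ is bounded. Then the series converges absolutely for $\Re s>1$ and $\eta$ has a (necessarily unique) meromorphic continuation to the half-plane $\Re s>0$, again denoted by $\eta$. Let $C_\eta$ be the space of all functions $h:(0,1)\to\mathbb C$ of the form $$h(x)=\sum_{k=1}^n b_k\,\kappa_\eta\!\left(\frac1{\theta_kx}\right),\qquad n\in\mathbb N,\ b_k\in\mathbb C,\ \theta_k\in[1,\infty),\qquad \beta\sum_{k=1}^n\frac{b_k}{\theta_k^{\alpha}}=0,$$ all of which belong to $L^p(0,1)$. Then for every real $p>1$ the following statements are equivalent: (i) $\eta$ has no zeros in the half-plane $\Re s>1/p$; (ii) the closure of $C_\eta$ in $L^p(0,1)$ is all of $L^p(0,1)$; (iii) the characteristic function $\mathbf 1_{[0,1]}$ belongs to the closure of $C_\eta$ in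 $L^p(0,1)$. -/

import Mathlib

open MeasureTheory Set
open scoped ENNReal

/-- The function `κ(x) = β x ^ α - ∑_{1 ≤ k ≤ x} a_k`. -/
noncomputable def kappa (a : ℕ → ℂ) (α β : ℝ) (x : ℝ) : ℂ :=
  ((β * x ^ α : ℝ) : ℂ) - ∑ k ∈ Finset.Icc 1 ⌊x⌋₊, a k

/-- The Dirichlet series `η(s) = ∑_{k ≥ 1} a_k k ^ (-s)` belongs to the class `𝒟`, with the
constants `α = α_η` and `β = β_η` (and `β = 0` whenever `α = 0`). The value `a 0` plays no role. -/
structure IsClassD (a : ℕ → ℂ) (α β : ℝ) : Prop where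
  coeff_one_ne_zero : a 1 ≠ 0
  alpha_nonneg : 0 ≤ α
  alpha_le_one : α ≤ 1
  beta_eq_zero : α = 0 → β = 0
  bounded : ∃ M : ℝ, ∀ x : ℝ, 0 < x → ‖kappa a α β x‖ ≤ M

/-- `F` is a meromorphic continuation to the half-plane `Re s > 0` of the Dirichlet series
`∑ a_k k ^ (-s)`, which (for a series of class `𝒟`) converges absolutely for `Re s > 1`. -/
structure IsDirichletContinuation (a : ℕ → ℂ) (F : ℂ → ℂ) : Prop where
  meromorphicOn : MeromorphicOn F {s : ℂ | 0 < s.re}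
  summable : ∀ s : ℂ, 1 < s.re → LSeriesSummable a s
  eq_LSeries : ∀ s : ℂ, 1 < s.re → F s = LSeries a s

/-- The meromorphic function `F` has no zero in the half-plane `Re s > σ`: its order
is nonpositive at every point (a pole is not a zero; values at removable
singularities and poles do not matter). -/
def NoZerosRightOf (F : ℂ → ℂ) (σ : ℝ) : Prop :=
  ∀ s : ℂ, σ < s.re → meromorphicOrderAt F s ≤ 0

/-- The space `C_η` of functions on `(0,1)`; the functions are written as functions on `ℝ` of which
only the values on `(0,1)` are prescribed. -/
def nymanSpace (a : ℕ → ℂ) (α β : ℝ) : Set (ℝ → ℂ) :=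
  {h | ∃ (n : ℕ) (b : Fin n → ℂ) (θ : Fin n → ℝ),
    (∀ k, 1 ≤ θ k) ∧
    (β : ℂ) * ∑ k, b k / ((θ k ^ α : ℝ) : ℂ) = 0 ∧
    ∀ x ∈ Ioo (0 : ℝ) 1, h x = ∑ k, b k * kappa a α β (1 / (θ k * x))}

/-- Lebesgue measure on the interval `(0,1)`. -/
noncomputable abbrev unitVolume : Measure ℝ := volume.restrict (Ioo (0 : ℝ) 1)

/-- The space `C_η`, viewed as a subset of `L^p(0,1)`. -/
def nymanSpaceLp (a : ℕ → ℂ) (α β : ℝ) (p : ℝ≥0∞) : Set (Lp ℂ p unitVolume) :=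
  {f | ∃ h ∈ nymanSpace a α β, f =ᵐ[unitVolume] h}

theorem measurable_kappa (a : ℕ → ℂ) (α β : ℝ) : Measurable (kappa a α β) := by
  unfold kappa
  have h1 : Measurable (fun n : ℕ => ∑ k ∈ Finset.Icc 1 n, a k) := measurable_from_nat
  have h2 : Measurable (fun x : ℝ => ∑ k ∈ Finset.Icc 1 ⌊x⌋₊, a k) := h1.comp Nat.measurable_floor
  have h3 : Measurable (fun x : ℝ => ((β * x ^ α : ℝ) : ℂ)) := by fun_prop
  exact h3.sub h2

/-- Every function in `C_η` is in `L^p(0,1)`, so that `nymanSpaceLp` loses none of them. -/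
theorem memLp_of_mem_nymanSpace {a : ℕ → ℂ} {α β : ℝ} (hD : IsClassD a α β) (p : ℝ≥0∞)
    {h : ℝ → ℂ} (hh : h ∈ nymanSpace a α β) : MemLp h p unitVolume := by
  obtain ⟨n, b, θ, hθ, -, hx⟩ := hh
  obtain ⟨M, hM⟩ := hD.bounded
  have hae : (fun x => ∑ k, b k * kappa a α β (1 / (θ k * x))) =ᵐ[unitVolume] h := by
    filter_upwards [ae_restrict_mem measurableSet_Ioo] with x hx'
    exact (hx x hx').symm
  refine MemLp.ae_eq hae ?_
  have hmeas : Measurable (fun x : ℝ => ∑ k, b k * kappa a α β (1 / (θ k * x))) := by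
    refine Finset.measurable_sum _ fun k _ => ?_
    refine Measurable.const_mul ((measurable_kappa a α β).comp ?_) _
    fun_prop
  refine MemLp.of_bound hmeas.aestronglyMeasurable (∑ k, ‖b k‖ * M) ?_
  filter_upwards [ae_restrict_mem measurableSet_Ioo] with x hx'
  refine (norm_sum_le _ _).trans (Finset.sum_le_sum fun k _ => ?_)
  rw [norm_mul]
  refine mul_le_mul_of_nonneg_left (hM _ ?_) (norm_nonneg _)
  have := hθ k
  have := hx'.1
  positivity

/-! ### Functionals on `L^p` of a finite measure, represented by integrable densities -/

section LpDual

open Filter Topology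

variable {X : Type*} [MeasurableSpace X] {μ : Measure X} [IsFiniteMeasure μ] {p : ℝ≥0∞}

/-! Write `B(w) = (w - α) ∫_1^∞ κ(x) x^(-w-1) dx - β`, the `mellinFactor` of `κ`. It is holomorphic
for `Re w > 0`, and Abel summation gives `η(s) = -s B(s) / (s - α)`. Once `α` is normalised to `0`
when `β = 0`, the zeros of `η` in `Re s > 0` are exactly the zeros of `B`.

A zero obstructs approximation. If `B(ρ) = 0` with `Re ρ > 1/p`, then `u^(ρ-1)` lies in the dual
space `L^q`. Integration against it annihilates `C_η`, because `(ρ - α) ∫_0^1 u^(ρ-1) κ(1/(θu)) du =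
β/θ^α + θ^(-ρ) B(ρ)` (`IsClassD.sub_mul_setIntegral_kappa`), but it takes the value `1/ρ` on the
constant `1`.

Conversely, let `B` have no zeros for `Re w > σ = 1/p` and let a functional with density `g`
annihilate `C_η`. Then `c(l) = ∫_0^1 κ(l/x) g(x) dx` equals `C l^α` on `(0,1)`, just as `κ(x) = β
x^α` there. With `G(w) = ∫_0^1 x^(-w) g(x) dx`, taking Mellin transforms gives `G B = D` in a strip
`0 < Re w < δ`, where `D` is the `mellinFactor` of `c` (`mellin_setIntegral_comp_div`,
`hasMellin_neg_of_eq_rpow`). Now `G` is holomorphic for `Re w < σ`, with `G(w) = O((σ - Re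
w)^(-σ))`, while `D/B` is holomorphic for `Re w > σ`. The two glue to an entire function `H`: a pole
on the line `Re w = σ` is incompatible with growth of exponent `σ < 1`.

To identify `H`, Borel–Carathéodory bounds `B` from below to the right of the line. A maximum
principle on small squares crosses the line, and Phragmén–Lindelöf then yields linear growth. So `H`
is affine, and it vanishes because it tends to `0` along the negative integers
(`eq_zero_of_mul_eq`). Thus `G = 0`, all moments of `g` vanish, `g = 0`, and Hahn–Banach gives
density. -/

theorem sum_indicatorConstLp_eq_biUnion {f : ℕ → Set X} (hf : ∀ i, MeasurableSet (f i))
    (hd : Pairwise (Function.onFun Disjoint f)) (s : Finset ℕ) :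
    ∑ i ∈ s, indicatorConstLp p (hf i) (measure_ne_top μ _) (1 : ℂ) =
      indicatorConstLp p (s.measurableSet_biUnion fun i _ => hf i) (measure_ne_top μ _) 1 := by
  classical
  induction s using Finset.induction_on with
  | empty => simp [indicatorConstLp_empty]
  | insert a s ha ih =>
    rw [Finset.sum_insert ha, ih, ← indicatorConstLp_disjoint_union]
    · congr 1
      simp
    · refine Set.disjoint_iUnion₂_right.2 fun i hi => hd ?_
      rintro rfl
      exact ha hi

variable [Fact (1 ≤ p)]

/-- This is where `p < ∞` enters: what remains of the union after finitely many pieces decreases to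
the empty set, so its measure, and with it the `L^p` distance, tends to zero. -/
theorem hasSum_indicatorConstLp (hp : p ≠ ∞) {f : ℕ → Set X} (hf : ∀ i, MeasurableSet (f i))
    (hd : Pairwise (Function.onFun Disjoint f)) :
    HasSum (fun i => indicatorConstLp p (hf i) (measure_ne_top μ _) (1 : ℂ))
      (indicatorConstLp p (MeasurableSet.iUnion hf) (measure_ne_top μ _) 1) := by
  unfold HasSum
  simp_rw [sum_indicatorConstLp_eq_biUnion hf hd]
  refine tendsto_indicatorConstLp_set hp ?_
  have h1 : ∀ s : Finset ℕ, symmDiff (⋃ b ∈ s, f b) (⋃ i, f i) = (⋃ i, f i) \ (⋃ b ∈ s, f b) := by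
    intro s
    rw [symmDiff_comm]
    exact symmDiff_of_ge (Set.iUnion₂_subset fun i _ => Set.subset_iUnion f i)
  simp_rw [SummationFilter.unconditional_filter, h1]
  have hanti : Antitone fun s : Finset ℕ => (⋃ i, f i) \ (⋃ b ∈ s, f b) := by
    intro s t hst
    exact Set.sdiff_subset_sdiff_right (Set.biUnion_subset_biUnion_left hst)
  have := tendsto_measure_iInter_atTop (μ := μ) (fun s : Finset ℕ =>
    ((MeasurableSet.iUnion hf).diff (s.measurableSet_biUnion fun i _ => hf i)).nullMeasurableSet)
    hanti ⟨∅, measure_ne_top μ _⟩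
  have h2 : ⋂ s : Finset ℕ, (⋃ i, f i) \ (⋃ b ∈ s, f b) = ∅ := by
    refine Set.eq_empty_of_forall_notMem fun x hx => ?_
    simp only [Set.mem_iInter, Set.mem_sdiff, Set.mem_iUnion, not_exists] at hx
    obtain ⟨i, hi⟩ := (hx ∅).1
    exact (hx {i}).2 i (by simp) hi
  rw [h2, measure_empty] at this
  exact this

open Classical in
/-- The signed measure `E ↦ ℓ (1_E)` attached to a real continuous functional on `L^p`. -/
noncomputable def signedMeasureOfLp (hp : p ≠ ∞) (ℓ : Lp ℂ p μ →L[ℝ] ℝ) : SignedMeasure X where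
  measureOf' E := if hE : MeasurableSet E then
    ℓ (indicatorConstLp p hE (measure_ne_top μ _) 1) else 0
  empty' := by simp [indicatorConstLp_empty]
  not_measurable' E hE := by simp [hE]
  m_iUnion' f hf hd := by
    simp only [hf, dif_pos, MeasurableSet.iUnion hf]
    exact (hasSum_indicatorConstLp hp hf hd).mapL ℓ

theorem signedMeasureOfLp_apply (hp : p ≠ ∞) (ℓ : Lp ℂ p μ →L[ℝ] ℝ) {E : Set X}
    (hE : MeasurableSet E) :
    signedMeasureOfLp hp ℓ E = ℓ (indicatorConstLp p hE (measure_ne_top μ _) 1) :=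
  dif_pos hE

/-- The set function `E ↦ ℓ (1_E)` is countably additive and vanishes on null sets, so Radon–Nikodym
for signed measures supplies the density. -/
theorem exists_integrable_setIntegral_eq_real (hp : p ≠ ∞) (ℓ : Lp ℂ p μ →L[ℝ] ℝ) :
    ∃ g : X → ℝ, Measurable g ∧ Integrable g μ ∧ ∀ (E : Set X) (hE : MeasurableSet E),
      ℓ (indicatorConstLp p hE (measure_ne_top μ _) 1) = ∫ x in E, g x ∂μ := by
  have hac : signedMeasureOfLp hp ℓ ≪ᵥ μ.toENNRealVectorMeasure := by
    refine VectorMeasure.AbsolutelyContinuous.mk fun E hE h0 => ?_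
    rw [Measure.toENNRealVectorMeasure_apply_measurable hE] at h0
    have : indicatorConstLp p hE (measure_ne_top μ _) (1 : ℂ) = 0 := by
      rw [Lp.eq_zero_iff_ae_eq_zero]
      refine indicatorConstLp_coeFn.trans ?_
      exact indicator_meas_zero h0
    rw [signedMeasureOfLp_apply hp ℓ hE, this, map_zero]
  refine ⟨(signedMeasureOfLp hp ℓ).rnDeriv μ, SignedMeasure.measurable_rnDeriv _ _,
    SignedMeasure.integrable_rnDeriv _ _,
    fun E hE => ?_⟩
  rw [← signedMeasureOfLp_apply hp ℓ hE, ← withDensityᵥ_apply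
    (SignedMeasure.integrable_rnDeriv _ _) hE, SignedMeasure.withDensityᵥ_rnDeriv_eq _ _ hac]

/-- Radon–Nikodym density of a continuous functional on `L^p` of a finite measure. -/
theorem exists_integrable_setIntegral_eq (hp : p ≠ ∞) (Λ : Lp ℂ p μ →L[ℂ] ℂ) :
    ∃ g : X → ℂ, Measurable g ∧ Integrable g μ ∧ ∀ (E : Set X) (hE : MeasurableSet E),
      Λ (indicatorConstLp p hE (measure_ne_top μ _) 1) = ∫ x in E, g x ∂μ := by
  obtain ⟨g₁, m₁, hg₁, h₁⟩ := exists_integrable_setIntegral_eq_real hp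
    (Complex.reCLM.comp (Λ.restrictScalars ℝ))
  obtain ⟨g₂, m₂, hg₂, h₂⟩ := exists_integrable_setIntegral_eq_real hp
    (Complex.imCLM.comp (Λ.restrictScalars ℝ))
  have hr : Integrable (fun x => (g₁ x : ℂ)) μ := hg₁.ofReal
  have hi : Integrable (fun x => (g₂ x : ℂ) * Complex.I) μ := hg₂.ofReal.mul_const _
  refine ⟨fun x => (g₁ x : ℂ) + (g₂ x : ℂ) * Complex.I, by fun_prop, hr.add hi, fun E hE => ?_⟩
  simp only
  rw [integral_add hr.integrableOn hi.integrableOn, integral_mul_const,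
    integral_complex_ofReal, integral_complex_ofReal, ← h₁ E hE, ← h₂ E hE]
  exact (Complex.re_add_im _).symm

/-- `g` represents the functional `Λ` on characteristic functions. -/
def RepresentsOnSets (Λ : Lp ℂ p μ →L[ℂ] ℂ) (g : X → ℂ) : Prop :=
  ∀ (E : Set X) (hE : MeasurableSet E),
      Λ (indicatorConstLp p hE (measure_ne_top μ _) 1) = ∫ x in E, g x ∂μ

theorem RepresentsOnSets.apply_simpleFunc {Λ : Lp ℂ p μ →L[ℂ] ℂ} {g : X → ℂ}
    (h : RepresentsOnSets Λ g) (hg : Integrable g μ) (φ : SimpleFunc X ℂ) (hφ : MemLp φ p μ) :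
    Integrable (fun x => φ x * g x) μ ∧ Λ (hφ.toLp φ) = ∫ x, φ x * g x ∂μ := by
  induction φ using SimpleFunc.induction with
  | @const c s hs =>
    have h1 : ∀ x, (SimpleFunc.piecewise s hs (SimpleFunc.const X c) (SimpleFunc.const X 0)) x
        * g x = s.indicator (fun x => c * g x) x := by
      intro x
      by_cases hx : x ∈ s <;> simp [hx]
    have h2 : hφ.toLp _ = c • indicatorConstLp p hs (measure_ne_top μ _) (1 : ℂ) := by
      rw [indicatorConstLp, ← MemLp.toLp_const_smul]
      refine MemLp.toLp_congr _ _ (Filter.Eventually.of_forall fun x => ?_)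
      by_cases hx : x ∈ s <;> simp [hx]
    simp_rw [h1]
    refine ⟨(hg.const_mul c).indicator hs, ?_⟩
    rw [h2, map_smul, h s hs, integral_indicator hs, integral_const_mul, smul_eq_mul]
  | @add f f' hd hf hf' =>
    have m1 : MemLp f p μ := MemLp.of_bound f.aestronglyMeasurable _
      (Filter.Eventually.of_forall f.exists_forall_norm_le.choose_spec)
    have m2 : MemLp f' p μ := MemLp.of_bound f'.aestronglyMeasurable _
      (Filter.Eventually.of_forall f'.exists_forall_norm_le.choose_spec)
    have h2 : hφ.toLp _ = m1.toLp f + m2.toLp f' := MemLp.toLp_add m1 m2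
    simp only [SimpleFunc.coe_add, Pi.add_apply, add_mul]
    refine ⟨(hf m1).1.add (hf' m2).1, ?_⟩
    rw [integral_add (hf m1).1 (hf' m2).1, ← (hf m1).2, ← (hf' m2).2, ← map_add]
    exact congrArg Λ h2

/-- Since `g` is only known to be integrable, the passage from simple functions is by dominated
convergence, which needs `f` bounded. -/
theorem RepresentsOnSets.apply_of_bound {Λ : Lp ℂ p μ →L[ℂ] ℂ} {g : X → ℂ}
    (h : RepresentsOnSets Λ g) (hp : p ≠ ∞) (hg : Integrable g μ) {f : X → ℂ}
    (hfm : Measurable f) {M : ℝ} (hM : ∀ x, ‖f x‖ ≤ M) (hf : MemLp f p μ) :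
    Λ (hf.toLp f) = ∫ x, f x * g x ∂μ := by
  have t1 := (Λ.continuous.tendsto _).comp (SimpleFunc.tendsto_approxOn_range_Lp hp hfm hf)
  refine tendsto_nhds_unique t1 ?_
  have h1 := fun n => (h.apply_simpleFunc hg _
    (SimpleFunc.memLp_approxOn_range hfm hf n)).2
  simp_rw [Function.comp_def, h1]
  refine tendsto_integral_of_dominated_convergence (fun x => (M + M) * ‖g x‖)
    (fun n => ((SimpleFunc.aestronglyMeasurable _).mul hg.1)) (hg.norm.const_mul _)
    (fun n => Filter.Eventually.of_forall fun x => ?_)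
    (Filter.Eventually.of_forall fun x => ?_)
  · rw [norm_mul]
    gcongr
    exact (SimpleFunc.norm_approxOn_zero_le hfm _ x n).trans (add_le_add (hM x) (hM x))
  · refine Tendsto.mul_const _ (SimpleFunc.tendsto_approxOn hfm _ (subset_closure (by simp)))

theorem RepresentsOnSets.eq_zero {Λ : Lp ℂ p μ →L[ℂ] ℂ} (hp : p ≠ ∞)
    (h : RepresentsOnSets Λ (fun _ => 0)) : Λ = 0 := by
  ext f
  refine Lp.induction hp (motive := fun f => Λ f = 0) ?_ ?_ ?_ f
  · intro c s hs hμ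
    have h2 : (Lp.simpleFunc.indicatorConst p hs hμ.ne c : Lp ℂ p μ)
        = c • indicatorConstLp p hs (measure_ne_top μ _) (1 : ℂ) := by
      rw [Lp.simpleFunc.coe_indicatorConst, indicatorConstLp, indicatorConstLp,
        ← MemLp.toLp_const_smul]
      refine MemLp.toLp_congr _ _ (Filter.Eventually.of_forall fun x => ?_)
      by_cases hx : x ∈ s <;> simp [hx]
    rw [h2, map_smul, h s hs]
    simp
  · intro f g hf hg _ h1 h2
    rw [map_add, h1, h2, add_zero]
  · exact isClosed_eq Λ.continuous continuous_const

/-- A substitute for `g ∈ L^q`: testing the functional on bounded truncations of `|f|`, with phases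
chosen to make the integrand nonnegative, bounds `∫ |f g|` by the operator norm. Applied to powers
of `x`, it controls the growth of `G`. -/
theorem RepresentsOnSets.integrable_mul {Λ : Lp ℂ p μ →L[ℂ] ℂ} {g : X → ℂ}
    (h : RepresentsOnSets Λ g) (hp : p ≠ ∞) (hg : Integrable g μ) (hgm : Measurable g)
    {f : X → ℂ} (hfm : Measurable f) (hf : MemLp f p μ) :
    Integrable (fun x => f x * g x) μ ∧
      ∫ x, ‖f x * g x‖ ∂μ ≤ ‖Λ‖ * (eLpNorm f p μ).toReal := by
  set φ : ℕ → Set X := fun n => {x | ‖f x‖ ≤ n}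
  have hφm : ∀ n, MeasurableSet (φ n) := fun n => measurableSet_le hfm.norm measurable_const
  have hφ : AECover μ atTop φ := by
    refine ⟨Filter.Eventually.of_forall fun x => ?_, hφm⟩
    obtain ⟨N, hN⟩ := exists_nat_ge ‖f x‖
    filter_upwards [eventually_ge_atTop N] with n hn
    exact hN.trans (by exact_mod_cast hn)
  have hI : ∀ n, IntegrableOn (fun x => f x * g x) (φ n) μ := by
    intro n
    refine Integrable.mono' ((hg.norm.const_mul (n : ℝ)).integrableOn (s := φ n))
      (hfm.mul hgm).aestronglyMeasurable ?_
    filter_upwards [ae_restrict_mem (hφm n)] with x hx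
    rw [norm_mul]
    exact mul_le_mul_of_nonneg_right hx (norm_nonneg _)
  have hbd : ∀ n, ∫ x in φ n, ‖f x * g x‖ ∂μ ≤ ‖Λ‖ * (eLpNorm f p μ).toReal := by
    intro n
    -- The factor `conj g / |g|` makes `u g = |f g|` on the truncation set; where `g = 0`, division
    -- by zero gives `0`, which is harmless.
    set u : X → ℂ := (φ n).indicator fun x =>
      (‖f x‖ : ℂ) * ((starRingEnd ℂ (g x)) / (‖g x‖ : ℂ))
    have hsg : ∀ x, ‖(starRingEnd ℂ (g x)) / (‖g x‖ : ℂ)‖ ≤ 1 := by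
      intro x
      rw [norm_div, RCLike.norm_conj, Complex.norm_real, norm_norm]
      exact div_self_le_one _
    have hum : Measurable u := by
      refine Measurable.indicator ?_ (hφm n)
      fun_prop
    have hu1 : ∀ x, ‖u x‖ ≤ ‖f x‖ := by
      intro x
      refine (norm_indicator_le_norm_self _ x).trans ?_
      rw [norm_mul, Complex.norm_real, norm_norm]
      exact mul_le_of_le_one_right (norm_nonneg _) (hsg x)
    have hu2 : ∀ x, ‖u x‖ ≤ n := by
      intro x
      by_cases hx : x ∈ φ n
      · exact (hu1 x).trans hx
      · simp [u, hx]
    have hul : MemLp u p μ := hf.mono hum.aestronglyMeasurable (Filter.Eventually.of_forall hu1)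
    have key := h.apply_of_bound hp hg hum hu2 hul
    have h3 : ∀ x, u x * g x = (φ n).indicator (fun x => ((‖f x * g x‖ : ℝ) : ℂ)) x := by
      intro x
      by_cases hx : x ∈ φ n
      · by_cases hgx : g x = 0
        · simp [u, hx, hgx]
        · have : (‖g x‖ : ℂ) ≠ 0 := by simpa using hgx
          simp only [u, Set.indicator_of_mem hx, norm_mul, Complex.ofReal_mul]
          have h4 := Complex.conj_mul' (g x)
          field_simp
          rw [mul_assoc, h4]
      · simp [u, hx]
    simp_rw [h3] at key
    rw [integral_indicator (hφm n), integral_complex_ofReal] at key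
    have h5 : ∫ x in φ n, ‖f x * g x‖ ∂μ = ‖Λ (hul.toLp u)‖ := by
      rw [key, Complex.norm_real, Real.norm_of_nonneg]
      exact integral_nonneg fun x => norm_nonneg _
    rw [h5]
    refine (Λ.le_opNorm _).trans ?_
    gcongr
    rw [Lp.norm_toLp]
    exact ENNReal.toReal_mono hf.2.ne (eLpNorm_mono hu1)
  have hint := hφ.integrable_of_integral_norm_bounded _ hI (Filter.Eventually.of_forall hbd)
  refine ⟨hint, ?_⟩
  exact le_of_tendsto' (hφ.integral_tendsto_of_countably_generated hint.norm) hbd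

end LpDual

/-! ### Borel–Carathéodory lower bound and a maximum principle on a square -/

section ComplexAnalysis

open Filter Topology Metric

/-- A lower bound for a bounded holomorphic function without zeros on a disc, in terms of its
value at the centre. -/
theorem le_norm_of_forall_ne_zero {f : ℂ → ℂ} {c z : ℂ} {R M m : ℝ} (hR : 0 < R)
    (hf : DifferentiableOn ℂ f (ball c R)) (h0 : ∀ z ∈ ball c R, f z ≠ 0)
    (hM : ∀ z ∈ ball c R, ‖f z‖ ≤ M) (hm : 0 < m) (hmc : m ≤ ‖f c‖) (hmM : m < M)
    (hz : z ∈ ball c R) :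
    m * Real.exp (-(2 * Real.log (M / m) * R / (R - ‖z - c‖))) ≤ ‖f z‖ := by
  have hc : c ∈ ball c R := mem_ball_self hR
  have hd : DifferentiableOn ℂ (fun z => deriv f z / f z) (ball c R) :=
    (hf.deriv isOpen_ball).div hf h0
  -- A primitive of `f' / f` vanishing at the centre, that is, a logarithm of `f / f(c)`. The upper
  -- bound on `|f|` bounds `Re l` from above, and Borel–Carathéodory turns this into a bound on
  -- `|l|`.
  obtain ⟨l, hlc, hl⟩ := hd.isExactOn_ball.with_val_at c 0
  have hexp : ∀ w ∈ ball c R, f w = f c * Complex.exp (l w) := by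
    intro w hw
    have hder : ∀ x ∈ ball c R, HasDerivAt (fun x => f x * Complex.exp (-l x)) 0 x := by
      intro x hx
      have h1 := (hf.differentiableAt (isOpen_ball.mem_nhds hx)).hasDerivAt
      have h2 : HasDerivAt (fun x => f x * Complex.exp (-l x)) (deriv f x * Complex.exp (-l x) +
          f x * (Complex.exp (-l x) * -(deriv f x / f x))) x := h1.mul (hl x hx).neg.cexp
      refine h2.congr_deriv ?_
      have := h0 x hx
      field_simp
      ring
    have hconst := isOpen_ball.is_const_of_deriv_eq_zero (convex_ball c R).isPreconnected
      (f := fun x => f x * Complex.exp (-l x))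
      (fun x hx => (hder x hx).differentiableAt.differentiableWithinAt)
      (fun x hx => (hder x hx).deriv) hw hc
    simp only [hlc, neg_zero, Complex.exp_zero, mul_one] at hconst
    rw [← hconst, mul_assoc, ← Complex.exp_add, neg_add_cancel, Complex.exp_zero, mul_one]
  have hfc : 0 < ‖f c‖ := hm.trans_le hmc
  have hlog : 0 < Real.log (M / m) := Real.log_pos ((one_lt_div hm).2 hmM)
  have hre : ∀ w ∈ ball c R, (l w).re ≤ Real.log (M / m) := by
    intro w hw
    have h1 := hM w hw
    rw [hexp w hw, norm_mul, Complex.norm_exp] at h1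
    rw [Real.le_log_iff_exp_le (div_pos (hm.trans hmM) hm), le_div_iff₀ hm, mul_comm]
    exact (mul_le_mul_of_nonneg_right hmc (Real.exp_pos _).le).trans h1
  have hl' : DifferentiableOn ℂ (fun u => l (c + u)) (ball 0 R) := by
    intro u hu
    have hu' : c + u ∈ ball c R := by simpa using hu
    exact ((hl _ hu').differentiableAt.comp u (by fun_prop)).differentiableWithinAt
  have hzc : z - c ∈ ball (0 : ℂ) R := by simpa [dist_eq_norm] using hz
  have hbc := Complex.borelCaratheodory_zero hlog hl'
    (fun u hu => hre _ (by simpa using hu)) hR hzc (by simpa using hlc)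
  simp only [add_sub_cancel] at hbc
  have hlt : ‖z - c‖ < R := by simpa using hzc
  have h3 : ‖l z‖ ≤ 2 * Real.log (M / m) * R / (R - ‖z - c‖) := by
    refine hbc.trans ?_
    have : 0 < R - ‖z - c‖ := by linarith
    gcongr
  rw [hexp z hz, norm_mul, Complex.norm_exp]
  gcongr
  have := (Complex.abs_re_le_norm (l z)).trans h3
  exact (abs_le.1 this).1

theorem one_div_two_mul_re_le_inv_re {v : ℂ} (hv : 0 < v.re) (h : |v.im| ≤ v.re) :
    1 / (2 * v.re) ≤ (v⁻¹).re := by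
  have h2 : v.im ^ 2 ≤ v.re ^ 2 := by
    rw [← sq_abs v.im]
    gcongr
  have h3 : 0 < v.re * v.re + v.im * v.im := by nlinarith
  rw [Complex.inv_re, Complex.normSq_apply, div_le_div_iff₀ (by positivity) h3]
  nlinarith

/-- A maximum principle on the square `|x| + |y| ≤ 1` for functions that grow at most like
`exp (L / |x|)` near the vertices `± i`. -/
theorem norm_le_of_le_exp_div_re {H : ℂ → ℂ} (hH : Differentiable ℂ H) {L : ℝ} (hL : 0 < L)
    (hb : ∀ z : ℂ, z.re ≠ 0 → |z.re| + |z.im| = 1 → ‖H z‖ ≤ Real.exp (L / |z.re|))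
    {x : ℝ} (hx : |x| < 1) : ‖H x‖ ≤ Real.exp (4 * L) := by
  classical
  -- `E` has its poles at the vertices `± i`, and on the rest of the square `Re E ≥ 1 / (2 (1 - |Im
  -- z|))`. On the boundary `1 - |Im z| = |Re z|`, so `exp (-2 L E)` compensates the growth `exp (L
  -- / |Re z|)`.
  set E : ℂ → ℂ := fun z => (1 + Complex.I * z)⁻¹ + (1 - Complex.I * z)⁻¹ with hE
  set V : Set ℂ := {Complex.I, -Complex.I} with hV
  -- The value `0` at the vertices makes `f` continuous on the closed square, because the damping
  -- factor is at most `(1 - |Im z|) / L`.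
  set f : ℂ → ℂ := fun z => if z ∈ V then 0 else H z * Complex.exp (-((2 * L : ℝ) : ℂ) * E z)
    with hf
  set N : ℂ → ℝ := fun z => |z.re| + |z.im| with hN
  have hNc : Continuous N := by fun_prop
  set U : Set ℂ := {z | N z < 1} with hU
  have hcl : closure U ⊆ {z | N z ≤ 1} := closure_lt_subset_le hNc continuous_const
  have hfr : frontier U ⊆ {z | N z = 1} := frontier_lt_subset_eq hNc continuous_const
  have hUo : IsOpen U := isOpen_lt hNc continuous_const
  have him : ∀ z : ℂ, N z ≤ 1 → z ∉ V → |z.im| < 1 := by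
    intro z hz hzV
    have h0 := abs_nonneg z.re
    by_contra! hcon
    have h1 : |z.im| = 1 := by simp only [hN] at hz; linarith
    have h2 : z.re = 0 := by
      rw [← abs_eq_zero]; simp only [hN] at hz; linarith
    apply hzV
    rcases eq_or_eq_neg_of_abs_eq h1 with h | h
    · left; apply Complex.ext <;> simp [h, h2]
    · right; apply Complex.ext <;> simp [h, h2]
  have hEre : ∀ z : ℂ, N z ≤ 1 → |z.im| < 1 → 1 / (2 * (1 - |z.im|)) ≤ (E z).re := by
    intro z hz hi
    obtain ⟨hi1, hi2⟩ := abs_lt.1 hi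
    have r1 : (1 + Complex.I * z).re = 1 - z.im := by simp; ring
    have r2 : (1 - Complex.I * z).re = 1 + z.im := by simp
    have i1 : (1 + Complex.I * z).im = z.re := by simp
    have i2 : (1 - Complex.I * z).im = -z.re := by simp
    have p1 : 0 ≤ ((1 + Complex.I * z)⁻¹).re := by
      rw [Complex.inv_re, r1]; exact div_nonneg (by linarith) (Complex.normSq_nonneg _)
    have p2 : 0 ≤ ((1 - Complex.I * z)⁻¹).re := by
      rw [Complex.inv_re, r2]; exact div_nonneg (by linarith) (Complex.normSq_nonneg _)
    simp only [hN] at hz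
    simp only [hE, Complex.add_re]
    rcases le_total 0 z.im with h | h
    · have := one_div_two_mul_re_le_inv_re (v := 1 + Complex.I * z) (by rw [r1]; linarith)
        (by rw [r1, i1]; rw [abs_of_nonneg h] at hz; linarith)
      rw [r1] at this
      rw [abs_of_nonneg h]
      linarith
    · have := one_div_two_mul_re_le_inv_re (v := 1 - Complex.I * z) (by rw [r2]; linarith)
        (by rw [r2, i2, abs_neg]; rw [abs_of_nonpos h] at hz; linarith)
      rw [r2] at this
      rw [abs_of_nonpos h, sub_neg_eq_add]
      linarith
  have hnorm : ∀ z, ‖Complex.exp (-((2 * L : ℝ) : ℂ) * E z)‖ = Real.exp (-(2 * L) * (E z).re) := by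
    intro z
    rw [Complex.norm_exp, ← Complex.ofReal_neg, Complex.re_ofReal_mul]
  have hfle : ∀ z : ℂ, N z ≤ 1 → ‖f z‖ ≤ ‖H z‖ * ((1 - |z.im|) / L) := by
    intro z hz
    have hz1 : |z.im| ≤ 1 := by
      have h0 := abs_nonneg z.re
      simp only [hN] at hz; linarith
    by_cases hzV : z ∈ V
    · simp only [hf, if_pos hzV, norm_zero]
      have : 0 ≤ 1 - |z.im| := by linarith
      positivity
    · have hi := him z hz hzV
      have h1 := hEre z hz hi
      simp only [hf, if_neg hzV, norm_mul, hnorm]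
      gcongr
      have h2 : 0 < 1 - |z.im| := by linarith
      calc Real.exp (-(2 * L) * (E z).re) ≤ Real.exp (-(L / (1 - |z.im|))) := by
            gcongr
            have : L / (1 - |z.im|) = 2 * L * (1 / (2 * (1 - |z.im|))) := by field_simp
            rw [this]
            nlinarith
        _ ≤ (L / (1 - |z.im|))⁻¹ := by
            rw [Real.exp_neg]
            apply inv_anti₀ (by positivity)
            linarith [Real.add_one_le_exp (L / (1 - |z.im|))]
        _ = (1 - |z.im|) / L := inv_div _ _
  have hVc : ∀ z ∉ V, 1 + Complex.I * z ≠ 0 ∧ 1 - Complex.I * z ≠ 0 := by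
    intro z hz
    simp only [hV, Set.mem_insert_iff, Set.mem_singleton_iff, not_or] at hz
    refine ⟨fun h => hz.1 ?_, fun h => hz.2 ?_⟩
    · linear_combination (-Complex.I) * h + z * Complex.I_mul_I
    · linear_combination (Complex.I) * h + z * Complex.I_mul_I
  have hVcl : IsClosed V := (Set.toFinite V).isClosed
  have hdiff : ∀ z ∉ V, DifferentiableAt ℂ f z := by
    intro z hz
    have h1 : f =ᶠ[𝓝 z] fun z => H z * Complex.exp (-((2 * L : ℝ) : ℂ) * E z) := by
      filter_upwards [hVcl.isOpen_compl.mem_nhds hz] with w hw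
      exact if_neg hw
    refine DifferentiableAt.congr_of_eventuallyEq ?_ h1
    obtain ⟨h2, h3⟩ := hVc z hz
    have hE' : DifferentiableAt ℂ E z := by
      refine DifferentiableAt.add ?_ ?_
      · exact DifferentiableAt.inv (by fun_prop) h2
      · exact DifferentiableAt.inv (by fun_prop) h3
    exact (hH z).mul ((hE'.const_mul _).cexp)
  have hVU : ∀ z ∈ U, z ∉ V := by
    rintro z hz (rfl | rfl) <;> simp [hU, hN] at hz
  have hcont : ContinuousOn f (closure U) := by
    intro z hz
    by_cases hzV : z ∈ V
    · have hfz : f z = 0 := if_pos hzV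
      have h1 : |z.im| = 1 := by rcases hzV with rfl | rfl <;> simp
      rw [ContinuousWithinAt, hfz]
      refine squeeze_zero_norm' (a := fun z => ‖H z‖ * ((1 - |z.im|) / L)) ?_ ?_
      · filter_upwards [self_mem_nhdsWithin] with w hw
        exact hfle w (hcl hw)
      · have hc : Continuous fun z : ℂ => ‖H z‖ * ((1 - |z.im|) / L) := by
          have := hH.continuous
          fun_prop
        have := hc.tendsto z
        rw [h1, sub_self, zero_div, mul_zero] at this
        exact this.mono_left nhdsWithin_le_nhds
    · exact (hdiff z hzV).continuousAt.continuousWithinAt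
  have hbdd : Bornology.IsBounded U := by
    refine (isBounded_ball (x := (0 : ℂ)) (r := 2)).subset fun z hz => ?_
    rw [mem_ball_zero_iff]
    have := Complex.norm_le_abs_re_add_abs_im z
    simp only [hU, hN, Set.mem_ofPred_eq] at hz
    linarith
  have hfront : ∀ z ∈ frontier U, ‖f z‖ ≤ 1 := by
    intro z hz
    have hz1 : N z = 1 := hfr hz
    by_cases hzV : z ∈ V
    · simp [hf, if_pos hzV]
    · have hi := him z hz1.le hzV
      have h1 := hEre z hz1.le hi
      have h2 : 1 - |z.im| = |z.re| := by simp only [hN] at hz1; linarith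
      have h3 : 0 < |z.re| := by linarith
      have h4 := hb z (abs_pos.1 h3) hz1
      simp only [hf, if_neg hzV, norm_mul, hnorm]
      calc _ ≤ Real.exp (L / |z.re|) * Real.exp (-(2 * L) * (E z).re) := by gcongr
        _ ≤ 1 := by
          rw [← Real.exp_add, Real.exp_le_one_iff]
          rw [h2] at h1
          have : L / |z.re| = 2 * L * (1 / (2 * |z.re|)) := by field_simp
          rw [this]
          nlinarith
  have hxU : (x : ℂ) ∈ closure U := subset_closure (by simpa [hU, hN] using hx)
  have hxV : (x : ℂ) ∉ V := by
    rintro (h | h) <;> simpa using congrArg Complex.im h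
  have h5 := Complex.norm_le_of_forall_mem_frontier_norm_le hbdd
    ⟨fun z hz => (hdiff z (hVU z hz)).differentiableWithinAt, hcont⟩ hfront hxU
  simp only [hf, if_neg hxV, norm_mul, hnorm] at h5
  -- On the real axis `E x = 2 / (1 + x²)`, so undoing the damping costs at most `exp (4 L)`.
  have h6 : (E x).re ≤ 2 := by
    simp only [hE, Complex.add_re, Complex.inv_re, Complex.normSq_apply]
    simp
    have : (1 + x * x)⁻¹ ≤ 1 := inv_le_one_of_one_le₀ (by nlinarith)
    linarith
  have h7 : ‖H x‖ ≤ Real.exp (2 * L * (E x).re) := by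
    rw [neg_mul, Real.exp_neg, ← div_eq_mul_inv, div_le_one (Real.exp_pos _)] at h5
    exact h5
  refine h7.trans (Real.exp_le_exp.2 (by nlinarith))

end ComplexAnalysis

/-! ### Gluing `G` and `D / B` to an entire function -/

section Extension

open Filter Topology Metric

theorem isOpen_re_lt (σ : ℝ) : IsOpen {w : ℂ | w.re < σ} :=
  isOpen_lt Complex.continuous_re continuous_const

theorem isOpen_lt_re (σ : ℝ) : IsOpen {w : ℂ | σ < w.re} :=
  isOpen_lt continuous_const Complex.continuous_re

theorem tendsto_sub_ofReal_nhdsNE (w : ℂ) :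
    Tendsto (fun t : ℝ => w - (t : ℂ)) (𝓝[>] 0) (𝓝[≠] w) := by
  refine tendsto_nhdsWithin_iff.2 ⟨?_, ?_⟩
  · have : Continuous fun t : ℝ => w - (t : ℂ) := by fun_prop
    have h := this.tendsto 0
    simp only [Complex.ofReal_zero, sub_zero] at h
    exact h.mono_left nhdsWithin_le_nhds
  · filter_upwards [self_mem_nhdsWithin] with t ht
    simpa using (ne_of_gt ht)

/-- A meromorphic function that is `O(t ^ (-σ))`, `σ < 1`, along a segment ending at `w` has no
pole at `w`. -/
theorem meromorphicOrderAt_nonneg_of_norm_le {f : ℂ → ℂ} {w : ℂ} (hf : MeromorphicAt f w)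
    {C σ : ℝ} (hσ : σ < 1) (hb : ∀ᶠ t : ℝ in 𝓝[>] 0, ‖f (w - t)‖ ≤ C * t ^ (-σ)) :
    0 ≤ meromorphicOrderAt f w := by
  by_contra! hneg
  have hm : MeromorphicAt (fun z => (z - w) * f z) w := by fun_prop
  have hzero : Tendsto (fun t : ℝ => (fun z => (z - w) * f z) (w - t)) (𝓝[>] 0) (𝓝 0) := by
    refine squeeze_zero_norm' (a := fun t : ℝ => C * t ^ (1 - σ)) ?_ ?_
    · filter_upwards [hb, self_mem_nhdsWithin] with t ht ht0
      have ht0 : (0 : ℝ) < t := ht0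
      rw [norm_mul, sub_sub_cancel_left, norm_neg, Complex.norm_real, Real.norm_of_nonneg ht0.le,
        sub_eq_add_neg 1 σ, Real.rpow_add ht0, Real.rpow_one]
      calc t * ‖f (w - t)‖ ≤ t * (C * t ^ (-σ)) := by gcongr
        _ = _ := by ring
    · have h1 : Tendsto (fun t : ℝ => C * t ^ (1 - σ)) (𝓝 0) (𝓝 (C * 0 ^ (1 - σ))) :=
        ((Real.continuousAt_rpow_const 0 (1 - σ) (Or.inr (by linarith))).tendsto).const_mul C
      rw [Real.zero_rpow (by linarith), mul_zero] at h1
      exact h1.mono_left nhdsWithin_le_nhds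
  have hpath := tendsto_sub_ofReal_nhdsNE w
  have hord : meromorphicOrderAt (fun z => (z - w) * f z) w ≤ 0 := by
    have h1 : meromorphicOrderAt (fun z => (z - w) * f z) w =
        meromorphicOrderAt (fun z => z - w) w + meromorphicOrderAt f w :=
      meromorphicOrderAt_mul (by fun_prop) hf
    rw [h1, meromorphicOrderAt_id_sub_const]
    lift meromorphicOrderAt f w to ℤ using hneg.ne_top with n hn
    norm_cast at hneg ⊢
    omega
  -- A pole of `f` leaves `(z - w) f` with order at most `0`, hence with a nonzero limit or an
  -- infinite one; the segment gives the limit `0`.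
  rcases hord.eq_or_lt with h0 | h0
  · obtain ⟨c, hc, hlim⟩ := tendsto_ne_zero_of_meromorphicOrderAt_eq_zero hm h0
    exact hc (tendsto_nhds_unique (hlim.comp hpath) hzero)
  · have h1 := (tendsto_cobounded_of_meromorphicOrderAt_neg h0).comp hpath
    exact hzero.not_tendsto (disjoint_nhds_cobounded 0) h1

/-- If `G B = D` near the imaginary axis, where `G` is holomorphic for `Re w < σ` and `B` has no
zeros for `Re w > σ`, and `G` grows slowly at the line `Re w = σ`, then `G` is entire. -/
theorem exists_entire_extension {G B D : ℂ → ℂ} {σ δ C : ℝ} (hσ0 : 0 < σ) (hσ1 : σ < 1)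
    (hδ : 0 < δ) (hδσ : δ ≤ σ)
    (hG : DifferentiableOn ℂ G {w | w.re < σ}) (hB : DifferentiableOn ℂ B {w | 0 < w.re})
    (hD : DifferentiableOn ℂ D {w | 0 < w.re})
    (hGC : ∀ w : ℂ, w.re < σ → ‖G w‖ ≤ C * (σ - w.re) ^ (-σ))
    (hGB : ∀ w : ℂ, 0 < w.re → w.re < δ → G w * B w = D w)
    (hB0 : ∀ w : ℂ, σ < w.re → B w ≠ 0) :
    ∃ H : ℂ → ℂ, Differentiable ℂ H ∧ (∀ w : ℂ, w.re < σ → H w = G w) ∧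
      ∀ w : ℂ, 0 < w.re → H w * B w = D w := by
  classical
  have o1 := isOpen_re_lt σ
  have o2 := isOpen_lt_re 0
  have hGa : ∀ w : ℂ, w.re < σ → AnalyticAt ℂ G w := fun w hw => hG.analyticAt (o1.mem_nhds hw)
  have hBa : ∀ w : ℂ, 0 < w.re → AnalyticAt ℂ B w := fun w hw => hB.analyticAt (o2.mem_nhds hw)
  have hDa : ∀ w : ℂ, 0 < w.re → AnalyticAt ℂ D w := fun w hw => hD.analyticAt (o2.mem_nhds hw)
  -- The identity theorem carries `G B = D` from the narrow strip to all of `0 < Re w < σ`.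
  have hstrip : ∀ w : ℂ, 0 < w.re → w.re < σ → G w * B w = D w := by
    set S : Set ℂ := {w | 0 < w.re} ∩ {w | w.re < σ}
    have hS : IsPreconnected S :=
      ((convex_halfSpace_re_gt 0).inter (convex_halfSpace_re_lt σ)).isPreconnected
    have h1 : AnalyticOnNhd ℂ (fun w => G w * B w) S := fun w hw =>
      (hGa w hw.2).mul (hBa w hw.1)
    have h2 : AnalyticOnNhd ℂ D S := fun w hw => hDa w hw.1
    have h3 : ((δ / 2 : ℝ) : ℂ) ∈ S := by
      constructor <;> simp only [Set.mem_ofPred_eq, Complex.ofReal_re] <;> linarith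
    have h4 := h1.eqOn_of_preconnected_of_eventuallyEq h2 hS h3 (by
      have hd : ((δ / 2 : ℝ) : ℂ) ∈ {w : ℂ | w.re < δ} := by
        simp only [Set.mem_ofPred_eq, Complex.ofReal_re]; linarith
      filter_upwards [o2.mem_nhds h3.1, (isOpen_re_lt δ).mem_nhds hd] with w hw1 hw2
      exact hGB w hw1 hw2)
    exact fun w hw1 hw2 => h4 ⟨hw1, hw2⟩
  set F : ℂ → ℂ := fun w => if w.re < σ then G w else D w / B w with hF
  have hFl : ∀ w : ℂ, w.re < σ → F =ᶠ[𝓝 w] G := fun w hw => by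
    filter_upwards [o1.mem_nhds hw] with z hz
    exact if_pos hz
  -- Zeros of `B` on the line itself are allowed, but they are isolated: `B` does not vanish at
  -- points immediately to the right.
  have hBne : ∀ w : ℂ, σ ≤ w.re → ∀ᶠ z in 𝓝[≠] w, B z ≠ 0 := by
    intro w hw
    refine (hBa w (by linarith)).eventually_eq_zero_or_eventually_ne_zero.resolve_left fun h => ?_
    have hpath : Tendsto (fun t : ℝ => w + (t : ℂ)) (𝓝[>] 0) (𝓝 w) := by
      have : Continuous fun t : ℝ => w + (t : ℂ) := by fun_prop
      have h := this.tendsto 0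
      simp only [Complex.ofReal_zero, add_zero] at h
      exact h.mono_left nhdsWithin_le_nhds
    obtain ⟨t, ht, ht0⟩ := ((hpath.eventually h).and self_mem_nhdsWithin).exists
    have ht0 : (0 : ℝ) < t := ht0
    exact hB0 _ (by simp only [Complex.add_re, Complex.ofReal_re]; linarith) ht
  have hFr : ∀ w : ℂ, σ ≤ w.re → F =ᶠ[𝓝[≠] w] fun z => D z / B z := by
    intro w hw
    have hw0 : 0 < w.re := by linarith
    filter_upwards [hBne w hw, mem_nhdsWithin_of_mem_nhds (o2.mem_nhds hw0)] with z hz hz0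
    by_cases h : z.re < σ
    · simp only [hF, if_pos h]
      rw [eq_div_iff hz, hstrip z hz0 h]
    · exact if_neg h
  have hFm : MeromorphicOn F univ := by
    intro w _
    rcases lt_or_ge w.re σ with h | h
    · exact (hGa w h).meromorphicAt.congr ((hFl w h).symm.filter_mono nhdsWithin_le_nhds)
    · have hw0 : 0 < w.re := by linarith
      exact ((hDa w hw0).meromorphicAt.div (hBa w hw0).meromorphicAt).congr (hFr w h).symm
  have hFo : ∀ w, 0 ≤ meromorphicOrderAt F w := by
    intro w
    rcases lt_trichotomy w.re σ with h | h | h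
    · rw [meromorphicOrderAt_congr ((hFl w h).filter_mono nhdsWithin_le_nhds)]
      exact (hGa w h).meromorphicOrderAt_nonneg
    -- On the line a zero of `B` could produce a pole of `D / B`; the growth of `G` along the
    -- horizontal segment from the left excludes it.
    · refine meromorphicOrderAt_nonneg_of_norm_le (hFm w trivial) hσ1 (C := C) ?_
      filter_upwards [self_mem_nhdsWithin] with t ht
      have ht : (0 : ℝ) < t := ht
      have h1 : (w - (t : ℂ)).re < σ := by simp [h, ht]
      have h2 := hGC _ h1
      simp only [hF, if_pos h1]
      simpa [h] using h2
    · rw [meromorphicOrderAt_congr (hFr w h.le)]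
      have hw0 : 0 < w.re := by linarith
      exact ((hDa w hw0).fun_div (hBa w hw0) (hB0 w h)).meromorphicOrderAt_nonneg
  set H := toMeromorphicNFOn F univ with hH
  have hHF : ∀ w, H =ᶠ[𝓝[≠] w] F := fun w => hFm.toMeromorphicNFOn_eq_self_on_nhdsNE trivial
  have hHa : ∀ w, AnalyticAt ℂ H w := by
    intro w
    rw [← (meromorphicNFOn_toMeromorphicNFOn F univ
      (Set.mem_univ w)).meromorphicOrderAt_nonneg_iff_analyticAt,
      meromorphicOrderAt_toMeromorphicNFOn hFm trivial]
    exact hFo w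
  refine ⟨H, fun w => (hHa w).differentiableAt, fun w hw => ?_, fun w hw => ?_⟩
  · have h1 : H =ᶠ[𝓝[≠] w] G := (hHF w).trans ((hFl w hw).filter_mono nhdsWithin_le_nhds)
    exact tendsto_nhds_unique
      ((hHa w).continuousAt.tendsto.mono_left nhdsWithin_le_nhds)
      (((hGa w hw).continuousAt.tendsto.mono_left nhdsWithin_le_nhds).congr' h1.symm)
  · have h1 : (fun z => H z * B z) =ᶠ[𝓝[≠] w] D := by
      rcases lt_or_ge w.re σ with h | h
      · filter_upwards [hHF w, mem_nhdsWithin_of_mem_nhds (o1.mem_nhds h),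
          mem_nhdsWithin_of_mem_nhds (o2.mem_nhds hw)] with z hz h1 h2
        rw [hz, ← hstrip z h2 h1]
        simp only [hF, if_pos (show z.re < σ from h1)]
      · filter_upwards [hHF w, hFr w h, hBne w h] with z hz h1 h2
        rw [hz, h1, div_mul_cancel₀ _ h2]
    exact tendsto_nhds_unique
      (((hHa w).continuousAt.mul (hBa w hw).continuousAt).tendsto.mono_left nhdsWithin_le_nhds)
      (((hDa w hw).continuousAt.tendsto.mono_left nhdsWithin_le_nhds).congr' h1.symm)

end Extension

/-! ### Growth of the entire function and its vanishing -/

section Growth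

open Filter Topology Metric

/-- Bound for `H = D / B` to the right of the line `Re w = σ`. -/
theorem exists_norm_le_exp_div {H B D : ℂ → ℂ} {σ σ₀ M c : ℝ} (hσ0 : 0 < σ)
    (hσ₀ : σ < σ₀) (hc : 0 < c) (hB : DifferentiableOn ℂ B {w | 0 < w.re})
    (hBM : ∀ w : ℂ, σ < w.re → ‖B w‖ ≤ M * (1 + ‖w‖))
    (hDM : ∀ w : ℂ, σ < w.re → ‖D w‖ ≤ M * (1 + ‖w‖))
    (hB0 : ∀ w : ℂ, σ < w.re → B w ≠ 0) (hBc : ∀ w : ℂ, σ₀ ≤ w.re → c ≤ ‖B w‖)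
    (hHB : ∀ w : ℂ, σ < w.re → H w * B w = D w) :
    ∃ A : ℝ, 0 < A ∧ ∀ w : ℂ, σ < w.re → w.re ≤ σ₀ →
      ‖H w‖ ≤ Real.exp (A * (1 + |w.im|) / (w.re - σ)) := by
  have hM0 : 0 ≤ M := by
    have h1 := hBM ((σ + 1 : ℝ) : ℂ) (by simp)
    by_contra! h
    have h2 : M * (1 + ‖((σ + 1 : ℝ) : ℂ)‖) < 0 := mul_neg_of_neg_of_pos h (by positivity)
    linarith [norm_nonneg (B ((σ + 1 : ℝ) : ℂ))]
  set R := σ₀ + 1 - σ with hR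
  have hR0 : 0 < R := by linarith
  set M' := M * (3 + 2 * σ₀) + 2 * c with hM'
  have hM'0 : 0 < M' := by have : 0 ≤ M * (3 + 2 * σ₀) := mul_nonneg hM0 (by linarith)
                           linarith
  set A₁ := 2 * (M' / c) * R with hA₁
  set A₂ := M * (1 + σ₀) / c with hA₂
  have hA₁0 : 0 < A₁ := by positivity
  have hσ₀0 : 0 < σ₀ := by linarith
  have hA₂0 : 0 ≤ A₂ := by positivity
  refine ⟨A₁ + A₂ * σ₀, by positivity, fun w hw hw2 => ?_⟩
  set y := |w.im| with hy
  have hy0 : 0 ≤ y := abs_nonneg _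
  -- The disc of radius `R` about `s` touches the line `Re z = σ`, and `s` has the same imaginary
  -- part as `w`. Hence the distance from `w` to its circle is exactly `Re w - σ`.
  set s : ℂ := ⟨σ₀ + 1, w.im⟩ with hs
  have hws : ‖w - s‖ = σ₀ + 1 - w.re := by
    have : w - s = ((w.re - (σ₀ + 1) : ℝ) : ℂ) := by apply Complex.ext <;> simp [hs]
    rw [this, Complex.norm_real, Real.norm_of_nonpos (by linarith)]
    ring
  have hball : ∀ z ∈ ball s R, σ < z.re := by
    intro z hz
    have h1 := (Complex.abs_re_le_norm (z - s)).trans_lt (mem_ball_iff_norm.1 hz)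
    have h2 := (abs_lt.1 h1).1
    simp only [Complex.sub_re, hs, hR] at h2
    linarith
  have hnw : ‖w‖ ≤ σ₀ + y := by
    have := Complex.norm_le_abs_re_add_abs_im w
    rw [abs_of_pos (by linarith : 0 < w.re)] at this
    linarith
  have hMball : ∀ z ∈ ball s R, ‖B z‖ ≤ M' * (1 + y) := by
    intro z hz
    have h1 : ‖z‖ ≤ σ₀ + 1 + y + R := by
      have h2 := mem_ball_iff_norm.1 hz
      have h3 : ‖s‖ ≤ σ₀ + 1 + y := by
        have := Complex.norm_le_abs_re_add_abs_im s
        simp only [hs] at this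
        rwa [abs_of_pos (by linarith : 0 < σ₀ + 1)] at this
      have := norm_le_norm_add_norm_sub' z s
      linarith
    refine (hBM z (hball z hz)).trans ?_
    calc M * (1 + ‖z‖) ≤ M * ((3 + 2 * σ₀) * (1 + y)) := by
          gcongr
          rw [hR] at h1
          nlinarith
      _ ≤ M' * (1 + y) := by rw [hM']; nlinarith
  have hcs : c ≤ ‖B s‖ := hBc s (by simp [hs])
  have hcM : c < M' * (1 + y) := by
    have : 0 ≤ M * (3 + 2 * σ₀) := mul_nonneg hM0 (by linarith)
    nlinarith
  have hwb : w ∈ ball s R := by rw [mem_ball_iff_norm, hws, hR]; linarith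
  have key := le_norm_of_forall_ne_zero hR0
    (hB.mono fun z hz => hσ0.trans (hball z hz)) (fun z hz => hB0 z (hball z hz)) hMball hc hcs
    hcM hwb
  have hx : R - ‖w - s‖ = w.re - σ := by rw [hws, hR]; ring
  rw [hx] at key
  set x := w.re - σ with hxdef
  have hx0 : 0 < x := by linarith
  have hlow : c * Real.exp (-(A₁ * (1 + y) / x)) ≤ ‖B w‖ := by
    refine le_trans ?_ key
    have hle : 2 * Real.log (M' * (1 + y) / c) * R ≤ A₁ * (1 + y) := by
      calc 2 * Real.log (M' * (1 + y) / c) * R ≤ 2 * (M' * (1 + y) / c) * R := by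
            gcongr
            exact Real.log_le_self (by positivity)
        _ = A₁ * (1 + y) := by rw [hA₁]; ring
    gcongr
  have hBw := hB0 w hw
  have hH : ‖H w‖ * ‖B w‖ ≤ M * (1 + ‖w‖) := by
    rw [← norm_mul, hHB w hw]
    exact hDM w hw
  have h1 : ‖H w‖ * (c * Real.exp (-(A₁ * (1 + y) / x))) ≤ M * ((1 + σ₀) * (1 + y)) := by
    refine (mul_le_mul_of_nonneg_left hlow (norm_nonneg _)).trans (hH.trans ?_)
    gcongr
    nlinarith
  have h2 : ‖H w‖ ≤ A₂ * (1 + y) * Real.exp (A₁ * (1 + y) / x) := by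
    rw [Real.exp_neg, ← div_eq_mul_inv, ← mul_div_assoc, div_le_iff₀ (Real.exp_pos _)] at h1
    rw [hA₂, show M * (1 + σ₀) / c * (1 + y) * Real.exp (A₁ * (1 + y) / x) =
      M * ((1 + σ₀) * (1 + y)) * Real.exp (A₁ * (1 + y) / x) / c by ring, le_div_iff₀ hc]
    exact h1
  refine h2.trans ?_
  calc A₂ * (1 + y) * Real.exp (A₁ * (1 + y) / x)
      ≤ Real.exp (A₂ * σ₀ * (1 + y) / x) * Real.exp (A₁ * (1 + y) / x) := by
        gcongr
        -- The polynomial factor is absorbed using `u ≤ exp u`, after inserting `σ₀ / x ≥ 1`.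
        have h3 : A₂ * (1 + y) ≤ A₂ * σ₀ * (1 + y) / x := by
          rw [le_div_iff₀ hx0]
          have : x ≤ σ₀ := by linarith
          have h4 : 0 ≤ A₂ * (1 + y) := by positivity
          nlinarith
        linarith [Real.add_one_le_exp (A₂ * σ₀ * (1 + y) / x)]
    _ = _ := by
        rw [← Real.exp_add]
        congr 1
        ring

/-- A uniform bound in a vertical strip from bounds that degenerate at the line `Re w = σ`. -/
theorem exists_norm_le_exp_strip {H : ℂ → ℂ} {σ σ₀ A C : ℝ} (hH : Differentiable ℂ H)
    (hσ0 : 0 < σ) (hσ1 : σ < 1) (hσ₀ : σ + 1 ≤ σ₀) (hA : 0 < A)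
    (hr : ∀ w : ℂ, σ < w.re → w.re ≤ σ₀ → ‖H w‖ ≤ Real.exp (A * (1 + |w.im|) / (w.re - σ)))
    (hl : ∀ w : ℂ, w.re < σ → ‖H w‖ ≤ C * (σ - w.re) ^ (-σ)) :
    ∃ A' : ℝ, 0 < A' ∧ ∀ w : ℂ, 0 ≤ w.re → w.re ≤ σ₀ → ‖H w‖ ≤ Real.exp (A' * (1 + |w.im|)) := by
  set A₁ := max A C with hA₁
  have hA₁0 : 0 < A₁ := lt_max_of_lt_left hA
  have hl' : ∀ w : ℂ, w.re < σ → σ - 1 ≤ w.re →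
      ‖H w‖ ≤ Real.exp (A₁ * (1 + |w.im|) / |w.re - σ|) := by
    intro w hw hw1
    have hx0 : 0 < σ - w.re := by linarith
    rw [abs_of_neg (show w.re - σ < 0 by linarith), neg_sub]
    have h1 : (σ - w.re) ^ (-σ) ≤ (σ - w.re)⁻¹ := by
      rw [← Real.rpow_neg_one]
      exact Real.rpow_le_rpow_of_exponent_ge hx0 (by linarith) (by linarith)
    have h2 : 0 ≤ |w.im| := abs_nonneg _
    calc ‖H w‖ ≤ C * (σ - w.re) ^ (-σ) := hl w hw
      _ ≤ A₁ * (σ - w.re) ^ (-σ) := by gcongr; exact le_max_right _ _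
      _ ≤ A₁ * (σ - w.re)⁻¹ := by gcongr
      _ ≤ A₁ * (1 + |w.im|) / (σ - w.re) := by
        rw [← div_eq_mul_inv]
        gcongr
        nlinarith
      _ ≤ _ := by linarith [Real.add_one_le_exp (A₁ * (1 + |w.im|) / (σ - w.re))]
  have hr' : ∀ w : ℂ, σ < w.re → w.re ≤ σ₀ →
      ‖H w‖ ≤ Real.exp (A₁ * (1 + |w.im|) / |w.re - σ|) := by
    intro w hw hw1
    rw [abs_of_pos (show 0 < w.re - σ by linarith)]
    refine (hr w hw hw1).trans (Real.exp_le_exp.2 ?_)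
    have : 0 < w.re - σ := by linarith
    gcongr
    exact le_max_left _ _
  have hboth : ∀ w : ℂ, w.re ≠ σ → σ - 1 ≤ w.re → w.re ≤ σ₀ →
      ‖H w‖ ≤ Real.exp (A₁ * (1 + |w.im|) / |w.re - σ|) := by
    intro w h1 h2 h3
    rcases lt_or_gt_of_ne h1 with h | h
    · exact hl' w h h2
    · exact hr' w h h3
  refine ⟨8 * A₁, by positivity, fun w hw0 hw1 => ?_⟩
  have hy0 := abs_nonneg w.im
  rcases lt_or_ge |w.re - σ| 1 with hx | hx
  -- The square is centred at the projection of `w` to the line. Inside it `|Im|` changes by at most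
  -- `1`, which doubles `1 + |Im w|`; together with the `4` of the maximum principle this gives `8 *
  -- A₁`.
  · set P : ℂ := ⟨σ, w.im⟩ with hP
    have h1 := norm_le_of_le_exp_div_re (H := fun z => H (P + z)) (L := 2 * A₁ * (1 + |w.im|))
      (by fun_prop) (by positivity) (fun z hz hz1 => by
        have hre : (P + z).re = σ + z.re := by simp [hP]
        have him : (P + z).im = w.im + z.im := by simp [hP]
        have hzi := abs_nonneg z.im
        have hzr := abs_pos.2 hz
        have hzr1 := abs_le.1 (show |z.re| ≤ 1 by linarith)
        have h2 := hboth (P + z) (by rw [hre]; simpa using hz) (by rw [hre]; linarith)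
          (by rw [hre]; linarith)
        refine h2.trans (Real.exp_le_exp.2 ?_)
        rw [hre, him, add_sub_cancel_left]
        have h3 := abs_add_le w.im z.im
        refine div_le_div_of_nonneg_right ?_ hzr.le
        nlinarith) hx
    have h2 : P + ((w.re - σ : ℝ) : ℂ) = w := by apply Complex.ext <;> simp [hP]
    simp only [h2] at h1
    refine h1.trans (Real.exp_le_exp.2 (le_of_eq (by ring)))
  · have hne : w.re ≠ σ := by
      rintro h
      rw [h, sub_self, abs_zero] at hx
      linarith
    refine (hboth w hne (by linarith) hw1).trans (Real.exp_le_exp.2 ?_)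
    refine (div_le_self (by positivity) hx).trans ?_
    gcongr
    linarith

/-- Phragmén–Lindelöf in the strip, applied to `H / (w + 1)`: this quotient is bounded on both
edges, and exponential growth in `|Im w|` is far below the double exponential growth the principle
tolerates. -/
theorem exists_norm_le_linear {H : ℂ → ℂ} {σ₀ A K : ℝ} (hH : Differentiable ℂ H)
    (hσ₀ : 0 < σ₀)
    (hs : ∀ w : ℂ, 0 ≤ w.re → w.re ≤ σ₀ → ‖H w‖ ≤ Real.exp (A * (1 + |w.im|)))
    (hl : ∀ w : ℂ, w.re ≤ 0 → ‖H w‖ ≤ K)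
    (hr : ∀ w : ℂ, σ₀ ≤ w.re → ‖H w‖ ≤ K * (1 + ‖w‖)) (hA : 0 < A) :
    ∀ w : ℂ, ‖H w‖ ≤ 2 * K * (1 + ‖w‖) := by
  have hK : 0 ≤ K := (norm_nonneg _).trans (hl 0 (by simp))
  have hone : ∀ w : ℂ, 0 ≤ w.re → 1 ≤ ‖w + 1‖ ∧ ‖w‖ ≤ ‖w + 1‖ := by
    intro w hw
    constructor
    · have := Complex.re_le_norm (w + 1)
      simp only [Complex.add_re, Complex.one_re] at this
      linarith
    · rw [← sq_le_sq₀ (norm_nonneg _) (norm_nonneg _), Complex.sq_norm, Complex.sq_norm,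
        Complex.normSq_apply, Complex.normSq_apply]
      simp only [Complex.add_re, Complex.one_re, Complex.add_im, Complex.one_im, add_zero]
      nlinarith
  have hPL : ∀ w : ℂ, 0 ≤ w.re → w.re ≤ σ₀ → ‖H w / (w + 1)‖ ≤ 2 * K := by
    intro w hw0 hw1
    have hne : ∀ z : ℂ, 0 ≤ z.re → z + 1 ≠ 0 := fun z hz h => by
      have := (hone z hz).1
      rw [h, norm_zero] at this
      linarith
    have hcl : closure (Complex.re ⁻¹' Ioo 0 σ₀) ⊆ {z : ℂ | 0 ≤ z.re} :=
      closure_minimal (fun z hz => hz.1.le) (isClosed_le continuous_const Complex.continuous_re)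
    refine PhragmenLindelof.vertical_strip (f := fun w => H w / (w + 1)) (a := 0) (b := σ₀)
      (C := 2 * K) ?_ ?_ ?_ ?_ hw0 hw1
    · refine DifferentiableOn.diffContOnCl fun z hz => ?_
      exact ((hH z).div (by fun_prop) (hne z (hcl hz))).differentiableWithinAt
    -- Any rate below `π / σ₀`, the critical one for a strip of width `σ₀`, would do.
    · set c := Real.pi / (2 * σ₀) with hc
      have hπ := Real.pi_pos
      have hc0 : 0 < c := by positivity
      refine ⟨c, ?_, A * (1 + 1 / c), ?_⟩
      · rw [hc, sub_zero]
        apply div_lt_div_of_pos_left hπ hσ₀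
        linarith
      · refine Asymptotics.IsBigO.of_bound 1 ?_
        filter_upwards [mem_inf_of_right (mem_principal_self _)] with z hz
        have hz0 : 0 ≤ z.re := hz.1.le
        rw [one_mul, Real.norm_of_nonneg (Real.exp_pos _).le, norm_div]
        refine (div_le_self (norm_nonneg _) (hone z hz0).1).trans ((hs z hz0 hz.2.le).trans ?_)
        rw [Real.exp_le_exp, mul_assoc]
        gcongr
        have hy0 := abs_nonneg z.im
        have h1 := Real.add_one_le_exp (c * |z.im|)
        have h2 : |z.im| ≤ 1 / c * Real.exp (c * |z.im|) := by
          rw [one_div, inv_mul_eq_div, le_div_iff₀ hc0]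
          linarith
        have h3 : 0 ≤ c * |z.im| := by positivity
        linarith
    · intro z hz
      rw [norm_div]
      refine (div_le_self (norm_nonneg _) (hone z hz.ge).1).trans ((hl z hz.le).trans ?_)
      linarith
    · intro z hz
      obtain ⟨h1, h2⟩ := hone z (by rw [hz]; exact hσ₀.le)
      rw [norm_div, div_le_iff₀ (by linarith)]
      refine (hr z hz.ge).trans ?_
      nlinarith
  intro w
  have hn := norm_nonneg w
  rcases le_total w.re 0 with h | h
  · refine (hl w h).trans ?_
    nlinarith [mul_nonneg hK hn]
  rcases le_total w.re σ₀ with h' | h'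
  · have h1 := hPL w h h'
    rw [norm_div, div_le_iff₀ (by linarith [(hone w h).1])] at h1
    refine h1.trans ?_
    gcongr
    have := norm_add_le w 1
    rw [norm_one] at this
    linarith
  · refine (hr w h').trans ?_
    nlinarith [mul_nonneg hK hn]

/-- An entire function of at most linear growth is affine. -/
theorem exists_affine_of_norm_le {H : ℂ → ℂ} {K : ℝ} (hH : Differentiable ℂ H)
    (hK : ∀ w : ℂ, ‖H w‖ ≤ K * (1 + ‖w‖)) : ∃ b : ℂ, ∀ w, H w = H 0 + w * b := by
  have hd : Differentiable ℂ (dslope H 0) := by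
    rw [← differentiableOn_univ, Complex.differentiableOn_dslope univ_mem, differentiableOn_univ]
    exact hH
  have hK0 : 0 ≤ K := by
    have := (norm_nonneg _).trans (hK 0)
    simpa using this
  -- Outside the unit disc the difference quotient is at most `K (2 + |w|) / |w| ≤ 3 K`; inside,
  -- compactness bounds it. Liouville then makes it constant.
  have hbd : Bornology.IsBounded (range (dslope H 0)) := by
    have h1 : Bornology.IsBounded (dslope H 0 '' closedBall 0 1) :=
      ((isCompact_closedBall 0 1).image hd.continuous).isBounded
    have h2 : range (dslope H 0) ⊆ dslope H 0 '' closedBall 0 1 ∪ closedBall 0 (3 * K) := by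
      rintro _ ⟨w, rfl⟩
      rcases le_total ‖w‖ 1 with h | h
      · exact Or.inl ⟨w, by simpa using h, rfl⟩
      · right
        have hw : w ≠ 0 := by
          rintro rfl
          simp only [norm_zero] at h
          linarith
        rw [mem_closedBall_zero_iff, dslope_of_ne _ hw, slope_def_field, sub_zero, norm_div,
          div_le_iff₀ (by linarith)]
        refine (norm_sub_le _ _).trans ?_
        have h3 := hK w
        have h4 := hK 0
        rw [norm_zero] at h4
        nlinarith
    exact (h1.union isBounded_closedBall).subset h2
  refine ⟨dslope H 0 0, fun w => ?_⟩
  rw [← hd.apply_eq_apply_of_bounded hbd w 0]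
  have := sub_smul_dslope H 0 w
  rw [sub_zero, smul_eq_mul] at this
  rw [this]
  ring

/-- Uniqueness: a function `G`, holomorphic for `Re w < σ` and slowly growing at the boundary,
that satisfies `G B = D` where `B` has no zeros for `Re w > σ` and is bounded below far to the
right, vanishes. -/
theorem eq_zero_of_mul_eq {G B D : ℂ → ℂ} {σ σ₀ δ C M c : ℝ} (hσ0 : 0 < σ) (hσ1 : σ < 1)
    (hδ : 0 < δ) (hδσ : δ ≤ σ) (hc : 0 < c)
    (hG : DifferentiableOn ℂ G {w | w.re < σ}) (hB : DifferentiableOn ℂ B {w | 0 < w.re})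
    (hD : DifferentiableOn ℂ D {w | 0 < w.re})
    (hGC : ∀ w : ℂ, w.re < σ → ‖G w‖ ≤ C * (σ - w.re) ^ (-σ))
    (hGB : ∀ w : ℂ, 0 < w.re → w.re < δ → G w * B w = D w)
    (hBM : ∀ w : ℂ, σ < w.re → ‖B w‖ ≤ M * (1 + ‖w‖))
    (hDM : ∀ w : ℂ, σ < w.re → ‖D w‖ ≤ M * (1 + ‖w‖))
    (hB0 : ∀ w : ℂ, σ < w.re → B w ≠ 0) (hBc : ∀ w : ℂ, σ₀ ≤ w.re → c ≤ ‖B w‖) :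
    ∀ w : ℂ, w.re < σ → G w = 0 := by
  obtain ⟨H, hH, hHG, hHB⟩ := exists_entire_extension hσ0 hσ1 hδ hδσ hG hB hD hGC hGB hB0
  have hHl : ∀ w : ℂ, w.re < σ → ‖H w‖ ≤ C * (σ - w.re) ^ (-σ) := fun w hw => by
    rw [hHG w hw]
    exact hGC w hw
  set σ₁ := max σ₀ 2 with hσ₁
  have hσ₁2 : 2 ≤ σ₁ := le_max_right _ _
  have hBc1 : ∀ w : ℂ, σ₁ ≤ w.re → c ≤ ‖B w‖ := fun w hw => hBc w ((le_max_left _ _).trans hw)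
  obtain ⟨A, hA, hHr⟩ := exists_norm_le_exp_div hσ0 (show σ < σ₁ by linarith) hc hB hBM hDM hB0
    hBc1 (fun w hw => hHB w (hσ0.trans hw))
  obtain ⟨A', hA', hHs⟩ := exists_norm_le_exp_strip hH hσ0 hσ1 (by linarith) hA hHr hHl
  have hC0 : 0 ≤ C := by
    have h1 := (norm_nonneg _).trans (hHl ((σ - 1 : ℝ) : ℂ) (by simp))
    simpa using h1
  have hleft : ∀ w : ℂ, w.re ≤ 0 → ‖H w‖ ≤ C * σ ^ (-σ) := fun w hw => by
    refine (hHl w (by linarith)).trans ?_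
    refine mul_le_mul_of_nonneg_left ?_ hC0
    exact Real.rpow_le_rpow_of_nonpos hσ0 (by linarith) (by linarith)
  have hright : ∀ w : ℂ, σ₁ ≤ w.re → ‖H w‖ ≤ M / c * (1 + ‖w‖) := fun w hw => by
    have h1 := hDM w (by linarith)
    rw [← hHB w (by linarith), norm_mul] at h1
    have h2 := mul_le_mul_of_nonneg_left (hBc1 w hw) (norm_nonneg (H w))
    rw [div_mul_eq_mul_div, le_div_iff₀ hc]
    linarith
  have hlin := exists_norm_le_linear (K := max (C * σ ^ (-σ)) (M / c)) hH
    (show 0 < σ₁ by linarith) hHs (fun w hw => (hleft w hw).trans (le_max_left _ _))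
    (fun w hw => (hright w hw).trans (by gcongr; exact le_max_right _ _)) hA'
  obtain ⟨b, hb⟩ := exists_affine_of_norm_le hH hlin
  have hlim : Tendsto (fun n : ℕ => H (-(n : ℂ))) atTop (𝓝 0) := by
    refine squeeze_zero_norm (a := fun n : ℕ => C * (σ + n) ^ (-σ)) (fun n => ?_) ?_
    · have := hHl (-(n : ℂ)) (by simpa using (neg_nonpos.2 (Nat.cast_nonneg n)).trans_lt hσ0)
      simpa using this
    · rw [← mul_zero C]
      refine Tendsto.const_mul C ((tendsto_rpow_neg_atTop hσ0).comp ?_)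
      exact tendsto_atTop_add_const_left _ _ tendsto_natCast_atTop_atTop
  -- The differences at consecutive negative integers all equal the slope `b` and tend to `0`.
  have hdiff : Tendsto (fun n : ℕ => H (-(n : ℂ)) - H (-((n + 1 : ℕ) : ℂ))) atTop (𝓝 (0 - 0)) :=
    hlim.sub (hlim.comp (tendsto_add_atTop_nat 1))
  have hb0 : b = 0 := by
    have h1 : ∀ n : ℕ, H (-(n : ℂ)) - H (-((n + 1 : ℕ) : ℂ)) = b := fun n => by
      rw [hb (-(n : ℂ)), hb (-((n + 1 : ℕ) : ℂ))]
      push_cast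
      ring
    simp_rw [h1, sub_zero] at hdiff
    exact tendsto_nhds_unique tendsto_const_nhds hdiff
  have hH0 : H 0 = 0 := by
    have h1 : ∀ n : ℕ, H (-(n : ℂ)) = H 0 := fun n => by rw [hb (-(n : ℂ)), hb0]; ring
    simp_rw [h1] at hlim
    exact tendsto_nhds_unique tendsto_const_nhds hlim
  intro w hw
  rw [← hHG w hw, hb w, hb0, hH0]
  ring

end Growth

/-! ### Mellin transforms of bounded functions that are a multiple of a power near zero -/

section Mellin

open Filter Topology Asymptotics

/-- The function `∫_1^∞ φ(x) x ^ (-w - 1) dx`. -/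
noncomputable def tailMellin (φ : ℝ → ℂ) (w : ℂ) : ℂ := mellin ((Ioi 1).indicator φ) (-w)

/-- The function `(w - α) ∫_1^∞ φ(x) x ^ (-w - 1) dx - b`. -/
noncomputable def mellinFactor (φ : ℝ → ℂ) (b : ℂ) (α : ℝ) (w : ℂ) : ℂ :=
  (w - α) * tailMellin φ w - b

variable {φ : ℝ → ℂ} {M : ℝ}

theorem norm_indicator_Ioi_one_le (hφ : ∀ x, 0 < x → ‖φ x‖ ≤ M) (x : ℝ) :
    ‖(Ioi 1).indicator φ x‖ ≤ M := by
  have hM : 0 ≤ M := (norm_nonneg _).trans (hφ 1 one_pos)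
  by_cases hx : x ∈ Ioi (1 : ℝ)
  · rw [indicator_of_mem hx]
    exact hφ x (one_pos.trans hx)
  · rw [indicator_of_notMem hx, norm_zero]
    exact hM

theorem locallyIntegrableOn_indicator_Ioi_one (hm : Measurable φ)
    (hφ : ∀ x, 0 < x → ‖φ x‖ ≤ M) : LocallyIntegrableOn ((Ioi 1).indicator φ) (Ioi 0) := by
  have h1 : MemLp ((Ioi 1).indicator φ) ∞ volume :=
    memLp_top_of_bound (hm.indicator measurableSet_Ioi).aestronglyMeasurable M
      (Eventually.of_forall (norm_indicator_Ioi_one_le hφ))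
  exact (h1.locallyIntegrable le_top).locallyIntegrableOn _

theorem indicator_Ioi_one_isBigO_atTop (hφ : ∀ x, 0 < x → ‖φ x‖ ≤ M) :
    (Ioi 1).indicator φ =O[atTop] fun x : ℝ => x ^ (-(0 : ℝ)) := by
  refine IsBigO.of_bound M (Eventually.of_forall fun x => ?_)
  simpa using norm_indicator_Ioi_one_le hφ x

theorem indicator_Ioi_one_isBigO_zero (b : ℝ) :
    (Ioi 1).indicator φ =O[𝓝[>] 0] fun x : ℝ => x ^ (-b) := by
  refine IsBigO.of_bound 1 ?_
  filter_upwards [mem_nhdsWithin_of_mem_nhds (Iio_mem_nhds (one_pos : (0 : ℝ) < 1))] with x hx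
  rw [indicator_of_notMem (by simpa using le_of_lt hx), norm_zero]
  positivity

theorem mellinConvergent_indicator_Ioi_one (hm : Measurable φ) (hφ : ∀ x, 0 < x → ‖φ x‖ ≤ M)
    {w : ℂ} (hw : 0 < w.re) : MellinConvergent ((Ioi 1).indicator φ) (-w) :=
  mellinConvergent_of_isBigO_rpow (locallyIntegrableOn_indicator_Ioi_one hm hφ)
    (indicator_Ioi_one_isBigO_atTop hφ) (by simpa using hw)
    (indicator_Ioi_one_isBigO_zero (-w.re - 1)) (by simp)

theorem differentiableOn_tailMellin (hm : Measurable φ) (hφ : ∀ x, 0 < x → ‖φ x‖ ≤ M) :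
    DifferentiableOn ℂ (tailMellin φ) {w | 0 < w.re} := by
  intro w hw
  have hw : 0 < w.re := hw
  have h1 : DifferentiableAt ℂ (mellin ((Ioi 1).indicator φ)) (-w) :=
    mellin_differentiableAt_of_isBigO_rpow (locallyIntegrableOn_indicator_Ioi_one hm hφ)
      (indicator_Ioi_one_isBigO_atTop hφ) (by simpa using hw)
      (indicator_Ioi_one_isBigO_zero (-w.re - 1)) (by simp)
  exact (h1.comp w differentiableAt_id.neg).differentiableWithinAt

theorem tailMellin_eq_integral (φ : ℝ → ℂ) (w : ℂ) :
    tailMellin φ w = ∫ t in Ioi (1 : ℝ), (t : ℂ) ^ (-w - 1) * φ t := by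
  have h1 : ∀ t : ℝ, (t : ℂ) ^ (-w - 1) • (Ioi 1).indicator φ t =
      (Ioi 1).indicator (fun t : ℝ => (t : ℂ) ^ (-w - 1) * φ t) t := by
    intro t
    by_cases ht : t ∈ Ioi (1 : ℝ) <;> simp [ht]
  rw [tailMellin, mellin]
  simp_rw [h1]
  rw [setIntegral_indicator measurableSet_Ioi, Ioi_inter_Ioi, sup_eq_right.2 zero_le_one]

theorem norm_tailMellin_le (hφ : ∀ x, 0 < x → ‖φ x‖ ≤ M) {w : ℂ} (hw : 0 < w.re) :
    ‖tailMellin φ w‖ ≤ M / w.re := by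
  rw [tailMellin_eq_integral]
  have hint : IntegrableOn (fun t : ℝ => t ^ (-w.re - 1) * M) (Ioi 1) :=
    (integrableOn_Ioi_rpow_of_lt (by linarith) one_pos).mul_const M
  refine (norm_integral_le_of_norm_le hint ?_).trans (le_of_eq ?_)
  · filter_upwards [ae_restrict_mem measurableSet_Ioi] with t ht
    have ht0 : 0 < t := one_pos.trans ht
    rw [norm_mul, Complex.norm_cpow_eq_rpow_re_of_pos ht0]
    simp only [Complex.sub_re, Complex.neg_re, Complex.one_re]
    gcongr
    exact hφ t ht0
  · rw [integral_mul_const, integral_Ioi_rpow_of_lt (by linarith) one_pos]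
    simp only [Real.one_rpow, sub_add_cancel]
    rw [neg_div_neg_eq]
    ring

theorem differentiableOn_mellinFactor (hm : Measurable φ) (hφ : ∀ x, 0 < x → ‖φ x‖ ≤ M)
    (b : ℂ) (α : ℝ) : DifferentiableOn ℂ (mellinFactor φ b α) {w | 0 < w.re} :=
  ((differentiableOn_id.sub_const _).mul (differentiableOn_tailMellin hm hφ)).sub_const _

theorem norm_mellinFactor_le (hφ : ∀ x, 0 < x → ‖φ x‖ ≤ M) (b : ℂ) {α : ℝ}
    {σ : ℝ} (hσ : 0 < σ) {w : ℂ} (hw : σ < w.re) :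
    ‖mellinFactor φ b α w‖ ≤ ((1 + |α|) * (M / σ) + ‖b‖) * (1 + ‖w‖) := by
  have hM : 0 ≤ M := (norm_nonneg _).trans (hφ 1 one_pos)
  have h1 : ‖tailMellin φ w‖ ≤ M / σ := (norm_tailMellin_le hφ (hσ.trans hw)).trans (by gcongr)
  have h2 : ‖w - (α : ℂ)‖ ≤ (1 + |α|) * (1 + ‖w‖) := by
    have := norm_sub_le w (α : ℂ)
    rw [Complex.norm_real, Real.norm_eq_abs] at this
    nlinarith [norm_nonneg w, abs_nonneg α, mul_nonneg (norm_nonneg w) (abs_nonneg α)]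
  calc ‖mellinFactor φ b α w‖ ≤ ‖w - (α : ℂ)‖ * ‖tailMellin φ w‖ + ‖b‖ := by
        rw [← norm_mul]
        exact norm_sub_le _ _
    _ ≤ (1 + |α|) * (1 + ‖w‖) * (M / σ) + ‖b‖ := by gcongr
    _ ≤ _ := by nlinarith [norm_nonneg b, mul_nonneg (norm_nonneg b) (norm_nonneg w)]

/-- The Mellin transform of a bounded function that is `b x ^ α` on `(0, 1)`. -/
theorem hasMellin_neg_of_eq_rpow (hm : Measurable φ) (hφ : ∀ x, 0 < x → ‖φ x‖ ≤ M) {b : ℂ}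
    {α : ℝ} (hb : ∀ x, 0 < x → x < 1 → φ x = b * ((x ^ α : ℝ) : ℂ)) {w : ℂ} (hw : 0 < w.re)
    (hα : b = 0 ∨ w.re < α) :
    MellinConvergent φ (-w) ∧ (w - α) * mellin φ (-w) = mellinFactor φ b α w := by
  have htail := mellinConvergent_indicator_Ioi_one hm hφ hw
  -- The part over `(0,1]` contributes `b / (α - w)`, convergent for `Re w < α`; multiplied by `w -
  -- α` it becomes the `-b` of `mellinFactor`.
  have hhead : HasMellin (fun t => b • (Ioc 0 1).indicator (fun t : ℝ => (t : ℂ) ^ (α : ℂ)) t) (-w)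
      (b • (1 / (-w + α))) := by
    rcases hα with rfl | hα
    · simp only [zero_smul]
      exact ⟨by simp [MellinConvergent], by simp [mellin]⟩
    · have h1 := hasMellin_cpow_Ioc (α : ℂ) (s := -w) (by simpa using hα)
      have h2 := hasMellin_const_smul h1.1 b
      rw [h1.2] at h2
      exact h2
  have hsum := hasMellin_add htail hhead.1
  have hae : ∀ᵐ t : ℝ ∂(volume.restrict (Ioi (0 : ℝ))),
      (t : ℂ) ^ (-w - 1) • ((Ioi 1).indicator φ t +
        b • (Ioc 0 1).indicator (fun t : ℝ => (t : ℂ) ^ (α : ℂ)) t) =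
      (t : ℂ) ^ (-w - 1) • φ t := by
    have hne : ∀ᵐ t : ℝ ∂(volume.restrict (Ioi (0 : ℝ))), t ≠ 1 :=
      ae_restrict_of_ae (Measure.ae_ne volume 1)
    filter_upwards [hne, ae_restrict_mem measurableSet_Ioi] with t ht ht0
    have ht0 : 0 < t := ht0
    congr 1
    rcases lt_or_gt_of_ne ht with h | h
    · rw [indicator_of_notMem (by simpa using h.le),
        indicator_of_mem (show t ∈ Ioc (0 : ℝ) 1 from ⟨ht0, h.le⟩), zero_add, hb t ht0 h,
        smul_eq_mul, Complex.ofReal_cpow ht0.le]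
    · rw [indicator_of_mem (show t ∈ Ioi (1 : ℝ) from h),
        indicator_of_notMem (fun h' : t ∈ Ioc (0 : ℝ) 1 => not_lt.2 h'.2 h), smul_zero, add_zero]
  have hmell : mellin φ (-w) = tailMellin φ w + b • (1 / (-w + α)) := by
    rw [tailMellin, ← hhead.2, ← hsum.2]
    exact (integral_congr_ae hae).symm
  refine ⟨Integrable.congr hsum.1 hae, ?_⟩
  rw [hmell, mellinFactor, mul_add]
  rcases hα with rfl | hα
  · simp
  · have hne : (-w + α : ℂ) ≠ 0 := by
      intro h
      have := congrArg Complex.re h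
      simp at this
      linarith
    rw [smul_eq_mul]
    field_simp
    ring

/-- The Mellin transform turns multiplicative convolution on `(0,1)` into a product. -/
theorem mellin_setIntegral_comp_div {φ g : ℝ → ℂ} (hφm : Measurable φ) (hgm : Measurable g)
    {w : ℂ} (hφ : MellinConvergent φ (-w))
    (hg : IntegrableOn (fun x : ℝ => (x : ℂ) ^ (-w) * g x) (Ioo 0 1)) :
    mellin (fun l => ∫ x in Ioo (0 : ℝ) 1, φ (l / x) * g x) (-w) =
      (∫ x in Ioo (0 : ℝ) 1, (x : ℂ) ^ (-w) * g x) * mellin φ (-w) := by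
  set F : ℝ → ℝ → ℂ := fun x l => (l : ℂ) ^ (-w - 1) * φ (l / x) * g x with hF
  have hslice : ∀ x : ℝ, 0 < x → MellinConvergent (fun l => φ (l / x)) (-w) := by
    intro x hx
    have := (MellinConvergent.comp_mul_left (f := φ) (s := -w) (inv_pos.2 hx)).2 hφ
    simpa only [div_eq_inv_mul] using this
  have hcpow : ∀ x : ℝ, 0 < x → ((x⁻¹ : ℝ) : ℂ) ^ w = (x : ℂ) ^ (-w) := by
    intro x hx
    rw [Complex.ofReal_inv, Complex.inv_cpow _ _ (by
      rw [Complex.arg_ofReal_of_nonneg hx.le]; exact Real.pi_pos.ne), Complex.cpow_neg]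
  have hval : ∀ x : ℝ, 0 < x →
      mellin (fun l => φ (l / x)) (-w) = (x : ℂ) ^ (-w) * mellin φ (-w) := by
    intro x hx
    have := mellin_comp_mul_left φ (-w) (inv_pos.2 hx)
    simp only [div_eq_inv_mul]
    rw [this, neg_neg, hcpow x hx, smul_eq_mul]
  have hmeas : Measurable (Function.uncurry F) := by
    simp only [hF, Function.uncurry_def]
    fun_prop
  set N := ∫ u in Ioi (0 : ℝ), ‖(u : ℂ) ^ (-w - 1) * φ u‖ with hN
  -- The substitution `l = x u` separates the variables, which gives the absolute integrability that
  -- Fubini requires.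
  have hnorm : ∀ x : ℝ, 0 < x →
      ∫ l in Ioi (0 : ℝ), ‖F x l‖ = ‖(x : ℂ) ^ (-w) * g x‖ * N := by
    intro x hx
    have h1 : ∀ l ∈ Ioi (0 : ℝ), ‖F x l‖ =
        ‖(x : ℂ) ^ (-w - 1) * g x‖ * ‖((l * x⁻¹ : ℝ) : ℂ) ^ (-w - 1) * φ (l * x⁻¹)‖ := by
      intro l hl
      have hl : 0 < l := hl
      have h2 : (l : ℂ) ^ (-w - 1) = (x : ℂ) ^ (-w - 1) * ((l * x⁻¹ : ℝ) : ℂ) ^ (-w - 1) := by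
        rw [← Complex.mul_cpow_ofReal_nonneg hx.le (by positivity), ← Complex.ofReal_mul]
        congr 2
        field_simp
      simp only [hF, h2, div_eq_mul_inv, norm_mul]
      ring
    rw [setIntegral_congr_fun measurableSet_Ioi h1, integral_const_mul,
      integral_comp_mul_right_Ioi (fun u : ℝ => ‖(u : ℂ) ^ (-w - 1) * φ u‖) 0 (inv_pos.2 hx),
      zero_mul, inv_inv, smul_eq_mul, ← hN, norm_mul, norm_mul, Complex.cpow_sub _ _
      (Complex.ofReal_ne_zero.2 hx.ne'), Complex.cpow_one, norm_div, Complex.norm_real,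
      Real.norm_of_nonneg hx.le]
    field_simp
  have hint : Integrable (Function.uncurry F)
      ((volume.restrict (Ioo (0 : ℝ) 1)).prod (volume.restrict (Ioi (0 : ℝ)))) := by
    rw [integrable_prod_iff hmeas.aestronglyMeasurable]
    constructor
    · filter_upwards [ae_restrict_mem measurableSet_Ioo] with x hx
      exact (hslice x hx.1).mul_const (g x)
    · refine (hg.norm.mul_const N).congr ?_
      filter_upwards [ae_restrict_mem measurableSet_Ioo] with x hx
      exact (hnorm x hx.1).symm
  calc mellin (fun l => ∫ x in Ioo (0 : ℝ) 1, φ (l / x) * g x) (-w)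
      = ∫ l in Ioi (0 : ℝ), ∫ x in Ioo (0 : ℝ) 1, F x l := by
        rw [mellin]
        congr 1 with l
        rw [smul_eq_mul, ← integral_const_mul]
        simp only [hF, mul_assoc]
    _ = ∫ x in Ioo (0 : ℝ) 1, ∫ l in Ioi (0 : ℝ), F x l := (integral_integral_swap hint).symm
    _ = ∫ x in Ioo (0 : ℝ) 1, ((x : ℂ) ^ (-w) * g x) * mellin φ (-w) := by
        refine setIntegral_congr_fun measurableSet_Ioo fun x hx => ?_
        have h1 : ∫ l in Ioi (0 : ℝ), F x l = mellin (fun l => φ (l / x)) (-w) * g x := by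
          rw [mellin, ← integral_mul_const]
          rfl
        simp only [h1, hval x hx.1]
        ring
    _ = _ := integral_mul_const _ _

theorem differentiableOn_setIntegral_cpow {g : ℝ → ℂ} (hgm : Measurable g) {σ : ℝ}
    (hg : ∀ τ < σ, IntegrableOn (fun x : ℝ => x ^ (-τ) * ‖g x‖) (Ioo 0 1)) :
    DifferentiableOn ℂ (fun w : ℂ => ∫ x in Ioo (0 : ℝ) 1, (x : ℂ) ^ (-w) * g x)
      {w | w.re < σ} := by
  intro w₀ hw₀
  have hw₀ : w₀.re < σ := hw₀
  -- Differentiation produces `log x`; one `ε` of the exponent absorbs it through `|log x| x ^ ε ≤ 1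
  -- / ε`, another covers the variation of `w`, and `τ` stays below `σ`.
  set ε := (σ - w₀.re) / 4 with hε
  have hε0 : 0 < ε := by linarith
  set τ := w₀.re + 2 * ε with hτ
  have hs : {w : ℂ | w.re < w₀.re + ε} ∈ 𝓝 w₀ :=
    (isOpen_re_lt _).mem_nhds (show w₀.re < w₀.re + ε by linarith)
  have hmeas : ∀ w : ℂ, Measurable fun x : ℝ => (x : ℂ) ^ (-w) * g x := fun w => by fun_prop
  have hint : Integrable (fun x : ℝ => (x : ℂ) ^ (-w₀) * g x) (volume.restrict (Ioo 0 1)) := by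
    refine (hg _ hw₀).mono' (hmeas w₀).aestronglyMeasurable ?_
    filter_upwards [ae_restrict_mem measurableSet_Ioo] with x hx
    rw [norm_mul, Complex.norm_cpow_eq_rpow_re_of_pos hx.1, Complex.neg_re]
  have key := hasDerivAt_integral_of_dominated_loc_of_deriv_le
    (F := fun (w : ℂ) (x : ℝ) => (x : ℂ) ^ (-w) * g x)
    (F' := fun (w : ℂ) (x : ℝ) => (x : ℂ) ^ (-w) * Complex.log x * (-1) * g x)
    (bound := fun x : ℝ => 1 / ε * (x ^ (-τ) * ‖g x‖)) hs
    (Eventually.of_forall fun w => (hmeas w).aestronglyMeasurable) hint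
    (by
      have : Measurable fun x : ℝ => (x : ℂ) ^ (-w₀) * Complex.log x * (-1) * g x := by fun_prop
      exact this.aestronglyMeasurable)
    (by
      filter_upwards [ae_restrict_mem measurableSet_Ioo] with x hx w hw
      have hw : w.re < w₀.re + ε := hw
      rw [norm_mul, norm_mul, norm_mul, norm_neg, norm_one, mul_one,
        Complex.norm_cpow_eq_rpow_re_of_pos hx.1, Complex.neg_re, ← Complex.ofReal_log hx.1.le,
        Complex.norm_real, ← mul_assoc]
      refine mul_le_mul_of_nonneg_right ?_ (norm_nonneg _)
      have h1 := (Real.abs_log_mul_self_rpow_lt x ε hx.1 hx.2.le hε0).le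
      rw [abs_mul, abs_of_pos (Real.rpow_pos_of_pos hx.1 ε)] at h1
      calc x ^ (-w.re) * ‖Real.log x‖ ≤ x ^ (ε + -τ) * ‖Real.log x‖ := by
            refine mul_le_mul_of_nonneg_right ?_ (norm_nonneg _)
            exact Real.rpow_le_rpow_of_exponent_ge hx.1 hx.2.le (by linarith)
        _ = (|Real.log x| * x ^ ε) * x ^ (-τ) := by
            rw [Real.rpow_add hx.1, Real.norm_eq_abs]
            ring
        _ ≤ 1 / ε * x ^ (-τ) := by
            refine mul_le_mul_of_nonneg_right h1 (Real.rpow_nonneg hx.1.le _))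
    ((hg τ (by linarith)).const_mul _)
    (by
      filter_upwards [ae_restrict_mem measurableSet_Ioo] with x hx w _
      have h1 : (x : ℂ) ≠ 0 := Complex.ofReal_ne_zero.2 hx.1.ne'
      exact ((hasDerivAt_neg w).const_cpow (Or.inl h1)).mul_const _)
  exact key.2.differentiableAt.differentiableWithinAt

end Mellin

/-! ### The continuation of `η` and its zeros -/

section DirichletSeries

open Filter Topology Asymptotics

/-- The terms after the first are dominated by those of `∑ |a n| n ^ (-Re s)`, which tends to `|a
1|` as `Re s → ∞`; this makes the bound uniform in `Im s`. -/
theorem exists_forall_norm_LSeries_ge {a : ℕ → ℂ} {C : ℝ} (hC : ∀ n ≠ 0, ‖a n‖ ≤ C)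
    (h1 : a 1 ≠ 0) : ∃ σ₀ : ℝ, ∀ s : ℂ, σ₀ ≤ s.re → ‖a 1‖ / 2 ≤ ‖LSeries a s‖ := by
  set b : ℕ → ℂ := fun n => (‖a n‖ : ℂ) with hb
  have hbC : ∀ n ≠ 0, ‖b n‖ ≤ C := fun n hn => by simpa [hb] using hC n hn
  have hlim := LSeries.tendsto_atTop (f := b)
    ((LSeries.abscissaOfAbsConv_le_of_le_const ⟨C, hbC⟩).trans_lt (EReal.coe_lt_top 1))
  have hpos : 0 < ‖a 1‖ / 2 := by positivity
  obtain ⟨σ₁, hσ₁⟩ := (eventually_atTop.1 ((Metric.tendsto_nhds.1 hlim) _ hpos))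
  refine ⟨max σ₁ 2, fun s hs => ?_⟩
  have hs1 : 1 < s.re := by linarith [(le_max_right σ₁ 2).trans hs]
  have hd := hσ₁ s.re ((le_max_left _ _).trans hs)
  have hsum : Summable (LSeries.term a s) := LSeriesSummable_of_bounded_of_one_lt_re hC hs1
  have hbs : LSeriesSummable b (s.re : ℂ) := LSeriesSummable_of_bounded_of_one_lt_real hbC hs1
  have hterm : ∀ n, LSeries.term b (s.re : ℂ) n = ((‖LSeries.term a s n‖ : ℝ) : ℂ) := by
    intro n
    rw [LSeries.norm_term_eq, LSeries.term_def]
    split_ifs with hn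
    · simp
    · rw [Complex.ofReal_div, Complex.ofReal_cpow (Nat.cast_nonneg n)]
      simp [hb]
  have e1 : LSeries a s = a 1 + ∑' n, ite (n = 1) 0 (LSeries.term a s n) := by
    have := hsum.tsum_eq_add_tsum_ite 1
    rw [show LSeries.term a s 1 = a 1 by simp] at this
    exact this
  have e2 : LSeries b (s.re : ℂ) =
      b 1 + ((∑' n, ‖ite (n = 1) 0 (LSeries.term a s n)‖ : ℝ) : ℂ) := by
    have := hbs.tsum_eq_add_tsum_ite 1
    rw [show LSeries.term b (s.re : ℂ) 1 = b 1 by simp] at this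
    rw [Complex.ofReal_tsum]
    refine this.trans ?_
    congr 2 with n
    split_ifs with hn
    · simp
    · rw [hterm]
  have e3 : ‖∑' n, ite (n = 1) 0 (LSeries.term a s n)‖ ≤ ‖a 1‖ / 2 := by
    have hs2 : Summable fun n => ‖ite (n = 1) 0 (LSeries.term a s n)‖ := by
      refine hsum.norm.of_nonneg_of_le (fun n => norm_nonneg _) fun n => ?_
      split_ifs <;> simp
    refine (norm_tsum_le_tsum_norm hs2).trans ?_
    rw [e2, dist_eq_norm, add_sub_cancel_left, Complex.norm_real] at hd
    exact (Real.le_norm_self _).trans hd.le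
  rw [e1]
  have := norm_sub_le_norm_add (a 1) (∑' n, ite (n = 1) 0 (LSeries.term a s n))
  linarith

namespace IsClassD

variable {a : ℕ → ℂ} {α β : ℝ}

theorem exists_norm_coeff_le (hD : IsClassD a α β) : ∃ C : ℝ, ∀ n ≠ 0, ‖a n‖ ≤ C := by
  obtain ⟨M, hM⟩ := hD.bounded
  refine ⟨M + M + |β|, fun n hn => ?_⟩
  obtain ⟨m, rfl⟩ := Nat.exists_eq_succ_of_ne_zero hn
  -- Between `u` and `m + 1` the partial sum changes by `a (m + 1)` alone, and `x ^ α` changes by at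
  -- most `1`, by subadditivity for `α ≤ 1`.
  set u : ℝ := m + 1 / 2 with hu
  have hu0 : 0 < u := by positivity
  have f1 : ⌊u⌋₊ = m := by
    rw [Nat.floor_eq_iff hu0.le]
    constructor <;> rw [hu] <;> linarith
  have f2 : ⌊((m + 1 : ℕ) : ℝ)⌋₊ = m + 1 := Nat.floor_natCast _
  have key : a (m + 1) = kappa a α β u - kappa a α β ((m + 1 : ℕ) : ℝ) +
      ((β * (((m + 1 : ℕ) : ℝ) ^ α - u ^ α) : ℝ) : ℂ) := by
    rw [kappa, kappa, f1, f2, Finset.sum_Icc_succ_top (by omega)]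
    push_cast
    ring
  have hmono : u ^ α ≤ ((m + 1 : ℕ) : ℝ) ^ α :=
    Real.rpow_le_rpow hu0.le (by rw [hu]; push_cast; linarith) hD.alpha_nonneg
  have hsub : ((m + 1 : ℕ) : ℝ) ^ α ≤ u ^ α + 1 := by
    have h1 := Real.rpow_add_le_add_rpow hu0.le (show (0 : ℝ) ≤ 1 / 2 by norm_num)
      hD.alpha_nonneg hD.alpha_le_one
    have h2 : (1 / 2 : ℝ) ^ α ≤ 1 := Real.rpow_le_one (by norm_num) (by norm_num) hD.alpha_nonneg
    have h3 : u + 1 / 2 = ((m + 1 : ℕ) : ℝ) := by rw [hu]; push_cast; ring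
    rw [h3] at h1
    linarith
  rw [Nat.succ_eq_add_one, key]
  refine (norm_add_le _ _).trans (add_le_add ((norm_sub_le _ _).trans
    (add_le_add (hM _ hu0) (hM _ (by positivity)))) ?_)
  rw [Complex.norm_real, norm_mul, Real.norm_eq_abs, Real.norm_of_nonneg (by linarith)]
  exact mul_le_of_le_one_right (abs_nonneg _) (by linarith)

theorem lseriesSummable (hD : IsClassD a α β) {s : ℂ} (hs : 1 < s.re) : LSeriesSummable a s := by
  obtain ⟨C, hC⟩ := hD.exists_norm_coeff_le
  exact LSeriesSummable_of_bounded_of_one_lt_re hC hs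

/-- Abel summation writes the series as `s ∫_1^∞ A(t) t^(-s-1) dt` with `A(t) = β t^α - κ(t)`; the
power integrates to `β / (s - α)`. -/
theorem lseries_eq (hD : IsClassD a α β) {s : ℂ} (hs : 1 < s.re) :
    LSeries a s = -(s * mellinFactor (kappa a α β) β α s) / (s - α) := by
  obtain ⟨C, hC⟩ := hD.exists_norm_coeff_le
  obtain ⟨M, hM⟩ := hD.bounded
  have hα1 := hD.alpha_le_one
  have hO : (fun n : ℕ => ∑ k ∈ Finset.Icc 1 n, a k) =O[atTop] fun n : ℕ => (n : ℝ) ^ (1 : ℝ) := by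
    refine IsBigO.of_bound C (Eventually.of_forall fun n => ?_)
    rw [Real.rpow_one, Real.norm_of_nonneg (Nat.cast_nonneg n)]
    refine (norm_sum_le_of_le _ fun k hk => hC k ?_).trans ?_
    · have := (Finset.mem_Icc.1 hk).1
      omega
    · rw [Finset.sum_const, Nat.card_Icc, nsmul_eq_mul, mul_comm]
      simp
  rw [LSeries_eq_mul_integral a zero_le_one hs (hD.lseriesSummable hs) hO]
  have hne : s - α ≠ 0 := by
    intro h
    have := congrArg Complex.re h
    simp at this
    linarith
  have hre : ((α : ℂ) - s - 1).re < -1 := by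
    simp
    linarith
  have hint1 : IntegrableOn (fun t : ℝ => (β : ℂ) * (t : ℂ) ^ ((α : ℂ) - s - 1)) (Ioi 1) :=
    (integrableOn_Ioi_cpow_of_lt hre one_pos).const_mul _
  have hconv := mellinConvergent_indicator_Ioi_one (measurable_kappa a α β) hM
    (show 0 < s.re by linarith)
  have hint2 : IntegrableOn (fun t : ℝ => (t : ℂ) ^ (-s - 1) * kappa a α β t) (Ioi 1) := by
    refine (IntegrableOn.mono_set hconv (Ioi_subset_Ioi zero_le_one)).congr_fun (fun t ht => ?_)
      measurableSet_Ioi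
    simp only [smul_eq_mul, indicator_of_mem ht]
  have hfun : ∀ t ∈ Ioi (1 : ℝ), (∑ k ∈ Finset.Icc 1 ⌊t⌋₊, a k) * (t : ℂ) ^ (-(s + 1)) =
      (β : ℂ) * (t : ℂ) ^ ((α : ℂ) - s - 1) - (t : ℂ) ^ (-s - 1) * kappa a α β t := by
    intro t ht
    have ht0 : (0 : ℝ) < t := one_pos.trans ht
    have hpow : (t : ℂ) ^ ((α : ℂ) - s - 1) = ((t ^ α : ℝ) : ℂ) * (t : ℂ) ^ (-s - 1) := by
      rw [Complex.ofReal_cpow ht0.le, ← Complex.cpow_add _ _ (Complex.ofReal_ne_zero.2 ht0.ne')]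
      congr 1
      ring
    rw [hpow, kappa, neg_add']
    push_cast
    ring
  rw [setIntegral_congr_fun measurableSet_Ioi hfun, integral_sub hint1 hint2, integral_const_mul,
    ← tailMellin_eq_integral, integral_Ioi_cpow_of_lt hre one_pos, mellinFactor,
    Complex.ofReal_one, Complex.one_cpow]
  have hne' : (α : ℂ) - s ≠ 0 := by rw [← neg_sub]; exact neg_ne_zero.2 hne
  rw [show (α : ℂ) - s - 1 + 1 = -(s - α) by ring]
  field_simp
  ring

theorem exists_norm_mellinFactor_ge (hD : IsClassD a α β) :
    ∃ c σ₀ : ℝ, 0 < c ∧ ∀ s : ℂ, σ₀ ≤ s.re → c ≤ ‖mellinFactor (kappa a α β) β α s‖ := by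
  obtain ⟨C, hC⟩ := hD.exists_norm_coeff_le
  have h1 := hD.coeff_one_ne_zero
  obtain ⟨σ₁, hσ₁⟩ := exists_forall_norm_LSeries_ge hC h1
  refine ⟨‖a 1‖ / 4, max σ₁ 2, by positivity, fun s hs => ?_⟩
  have hs2 : 2 ≤ s.re := (le_max_right σ₁ 2).trans hs
  have h2 := hσ₁ s ((le_max_left _ _).trans hs)
  have hn : 2 ≤ ‖s‖ := hs2.trans (Complex.re_le_norm s)
  have h3 : ‖s‖ / 2 ≤ ‖s - α‖ := by
    have := norm_sub_norm_le s (α : ℂ)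
    rw [Complex.norm_real, Real.norm_of_nonneg hD.alpha_nonneg] at this
    linarith [hD.alpha_le_one]
  rw [hD.lseries_eq (by linarith), norm_div, norm_neg, norm_mul, le_div_iff₀ (by linarith)] at h2
  have h4 : ‖a 1‖ / 2 * (‖s‖ / 2) ≤ ‖s‖ * ‖mellinFactor (kappa a α β) β α s‖ :=
    (mul_le_mul_of_nonneg_left h3 (by positivity)).trans h2
  have h5 : 0 < ‖s‖ := by linarith
  refine le_of_mul_le_mul_left ?_ h5
  linarith

theorem meromorphicAt_continuation (hD : IsClassD a α β) {s : ℂ} (hs : 0 < s.re) :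
    MeromorphicAt (fun s : ℂ => -(s * mellinFactor (kappa a α β) β α s) / (s - α)) s := by
  obtain ⟨M, hM⟩ := hD.bounded
  have h1 : AnalyticAt ℂ (mellinFactor (kappa a α β) β α) s :=
    (differentiableOn_mellinFactor (measurable_kappa a α β) hM β α).analyticAt
      ((isOpen_lt_re 0).mem_nhds hs)
  have h2 := h1.meromorphicAt
  fun_prop

theorem isDirichletContinuation (hD : IsClassD a α β) : IsDirichletContinuation a
    (fun s : ℂ => -(s * mellinFactor (kappa a α β) β α s) / (s - α)) where
  meromorphicOn _ hs := hD.meromorphicAt_continuation hs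
  summable _ hs := hD.lseriesSummable hs
  eq_LSeries _ hs := (hD.lseries_eq hs).symm

end IsClassD

/-- The difference of two continuations vanishes near `2`, hence on punctured neighbourhoods
throughout the connected half-plane, so zeros may be studied on the explicit continuation. -/
theorem IsDirichletContinuation.meromorphicOrderAt_eq {a : ℕ → ℂ} {F₁ F₂ : ℂ → ℂ}
    (h₁ : IsDirichletContinuation a F₁) (h₂ : IsDirichletContinuation a F₂) {s : ℂ}
    (hs : 0 < s.re) : meromorphicOrderAt F₁ s = meromorphicOrderAt F₂ s := by
  have hm : MeromorphicOn (F₁ - F₂) {s : ℂ | 0 < s.re} := h₁.meromorphicOn.sub h₂.meromorphicOn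
  have htop : meromorphicOrderAt (F₁ - F₂) 2 = ⊤ := by
    rw [meromorphicOrderAt_eq_top_iff]
    have : (2 : ℂ) ∈ {s : ℂ | 1 < s.re} := by simp
    filter_upwards [mem_nhdsWithin_of_mem_nhds ((isOpen_lt_re 1).mem_nhds this)] with z hz
    rw [Pi.sub_apply, h₁.eq_LSeries z hz, h₂.eq_LSeries z hz, sub_self]
  have htop' : meromorphicOrderAt (F₁ - F₂) s = ⊤ := by
    by_contra h
    exact hm.meromorphicOrderAt_ne_top_of_isPreconnected
      (convex_halfSpace_re_gt 0).isPreconnected hs (show (0 : ℝ) < (2 : ℂ).re by simp) h htop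
  refine meromorphicOrderAt_congr ?_
  filter_upwards [meromorphicOrderAt_eq_top_iff.1 htop'] with z hz
  exact sub_eq_zero.1 hz

/-- Away from `α` the factor `-s / (s - α)` is finite and nonzero; at `α` neither side holds, as
`B(α) = -β ≠ 0`. The normalisation `hβ` is essential: for `β = 0 < α`, `B` would have a spurious
zero at `α`. -/
theorem IsDirichletContinuation.meromorphicOrderAt_pos_iff {a : ℕ → ℂ} {α β : ℝ} {F : ℂ → ℂ}
    (hF : IsDirichletContinuation a F) (hD : IsClassD a α β) (hβ : β = 0 → α = 0) {s : ℂ}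
    (hs : 0 < s.re) :
    0 < meromorphicOrderAt F s ↔ mellinFactor (kappa a α β) β α s = 0 := by
  obtain ⟨M, hM⟩ := hD.bounded
  set B := mellinFactor (kappa a α β) β α with hB
  have hBa : AnalyticAt ℂ B s :=
    (differentiableOn_mellinFactor (measurable_kappa a α β) hM β α).analyticAt
      ((isOpen_lt_re 0).mem_nhds hs)
  have hs0 : s ≠ 0 := by
    rintro rfl
    simp at hs
  rw [hF.meromorphicOrderAt_eq hD.isDirichletContinuation hs,
    ← tendsto_zero_iff_meromorphicOrderAt_pos (hD.meromorphicAt_continuation hs)]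
  by_cases hsα : s = α
  · have hβ0 : β ≠ 0 := by
      intro h
      rw [hβ h, Complex.ofReal_zero] at hsα
      exact hs0 hsα
    have hBs : B s ≠ 0 := by
      rw [hB, mellinFactor, hsα, sub_self, zero_mul, zero_sub]
      exact neg_ne_zero.2 (Complex.ofReal_ne_zero.2 hβ0)
    refine ⟨fun h => ?_, fun h => absurd h hBs⟩
    have h1 : Tendsto (fun z : ℂ => z - α) (𝓝[≠] s) (𝓝 0) := by
      have : Continuous fun z : ℂ => z - α := by fun_prop
      have h := this.tendsto s
      rw [show s - (α : ℂ) = 0 by rw [hsα, sub_self]] at h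
      exact h.mono_left nhdsWithin_le_nhds
    have h2 := h1.mul h
    rw [zero_mul] at h2
    have h3 : Tendsto (fun z : ℂ => -(z * B z)) (𝓝[≠] s) (𝓝 (-(s * B s))) :=
      ((continuousAt_id.mul hBa.continuousAt).neg.tendsto).mono_left nhdsWithin_le_nhds
    have h4 : Tendsto (fun z : ℂ => -(z * B z)) (𝓝[≠] s) (𝓝 0) := by
      refine h2.congr' ?_
      filter_upwards [self_mem_nhdsWithin] with z hz
      have : z - α ≠ 0 := by
        rw [← hsα]
        exact sub_ne_zero.2 hz
      rw [← hB]
      field_simp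
    have h5 := tendsto_nhds_unique h3 h4
    exact absurd (neg_eq_zero.1 h5) (mul_ne_zero hs0 hBs)
  · have hne : s - α ≠ 0 := sub_ne_zero.2 hsα
    have hc : ContinuousAt (fun z : ℂ => -(z * B z) / (z - α)) s :=
      (continuousAt_id.mul hBa.continuousAt).neg.div (by fun_prop) hne
    have h1 := hc.tendsto.mono_left (nhdsWithin_le_nhds (s := {s}ᶜ))
    constructor
    · intro h
      have h2 := tendsto_nhds_unique h1 h
      simpa [hs0, hne] using h2
    · intro h
      simpa [h] using h1

end DirichletSeries

/-! ### Powers in `L^p(0,1)` and vanishing moments -/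

section PowerFunctions

open Filter Topology

theorem measurable_ofReal_cpow_const (r : ℂ) : Measurable fun x : ℝ => (x : ℂ) ^ r := by
  fun_prop

theorem memLp_ofReal_cpow {q : ℝ≥0∞} (hq0 : q ≠ 0) (hq : q ≠ ∞) {r : ℂ}
    (hr : -1 < r.re * q.toReal) : MemLp (fun x : ℝ => (x : ℂ) ^ r) q unitVolume := by
  refine (integrable_norm_rpow_iff (measurable_ofReal_cpow_const r).aestronglyMeasurable hq0
    hq).1 ?_
  have h1 := (intervalIntegral.integrableOn_Ioo_rpow_iff (s := r.re * q.toReal) one_pos).2 hr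
  refine h1.congr_fun (fun x hx => ?_) measurableSet_Ioo
  simp only
  rw [Complex.norm_cpow_eq_rpow_re_of_pos hx.1, Real.rpow_mul hx.1.le]

theorem eLpNorm_ofReal_cpow {q : ℝ≥0∞} (hq0 : q ≠ 0) (hq : q ≠ ∞) {r : ℂ}
    (hr : -1 < r.re * q.toReal) :
    (eLpNorm (fun x : ℝ => (x : ℂ) ^ r) q unitVolume).toReal =
      (1 / (r.re * q.toReal + 1)) ^ (q.toReal⁻¹) := by
  rw [(memLp_ofReal_cpow hq0 hq hr).eLpNorm_eq_integral_rpow_norm hq0 hq,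
    ENNReal.toReal_ofReal (by positivity)]
  congr 1
  have h1 : ∀ x ∈ Ioo (0 : ℝ) 1, ‖(x : ℂ) ^ r‖ ^ q.toReal = x ^ (r.re * q.toReal) := by
    intro x hx
    rw [Complex.norm_cpow_eq_rpow_re_of_pos hx.1, Real.rpow_mul hx.1.le]
  rw [setIntegral_congr_fun measurableSet_Ioo h1, ← integral_Ioc_eq_integral_Ioo,
    ← intervalIntegral.integral_of_le zero_le_one, integral_rpow (Or.inl hr), Real.one_rpow,
    Real.zero_rpow (by linarith), sub_zero]

/-- An integrable function on `(0,1)` all of whose moments vanish is zero. -/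
theorem ae_eq_zero_of_moments_eq_zero {g : ℝ → ℂ} (hg : Integrable g unitVolume)
    (h : ∀ n : ℕ, ∫ x in Ioo (0 : ℝ) 1, (x : ℂ) ^ n * g x = 0) : ∀ᵐ x ∂unitVolume, g x = 0 := by
  refine ae_eq_zero_of_integral_contDiff_smul_eq_zero hg.locallyIntegrable fun f hf _ => ?_
  have hpow : ∀ n : ℕ, Integrable (fun x : ℝ => (x : ℂ) ^ n * g x) unitVolume := by
    intro n
    refine hg.norm.mono'
      ((Complex.measurable_ofReal.pow_const n).aestronglyMeasurable.mul hg.1) ?_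
    filter_upwards [ae_restrict_mem measurableSet_Ioo] with x hx
    rw [norm_mul, norm_pow, Complex.norm_real, Real.norm_of_nonneg hx.1.le]
    exact mul_le_of_le_one_left (norm_nonneg _) (pow_le_one₀ hx.1.le hx.2.le)
  have hpoly : ∀ P : Polynomial ℝ, Integrable (fun x => P.eval x • g x) unitVolume ∧
      ∫ x in Ioo (0 : ℝ) 1, P.eval x • g x = 0 := by
    intro P
    induction P using Polynomial.induction_on' with
    | add P Q hP hQ =>
      simp only [Polynomial.eval_add, add_smul]
      refine ⟨hP.1.add hQ.1, ?_⟩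
      rw [integral_add hP.1 hQ.1, hP.2, hQ.2, add_zero]
    | monomial n c =>
      have h1 : ∀ x : ℝ, (Polynomial.monomial n c).eval x • g x =
          (c : ℂ) * ((x : ℂ) ^ n * g x) := by
        intro x
        rw [Polynomial.eval_monomial, Complex.real_smul]
        push_cast
        ring
      simp_rw [h1]
      refine ⟨(hpow n).const_mul _, ?_⟩
      rw [integral_const_mul, h n, mul_zero]
  have hK : 0 ≤ ∫ x in Ioo (0 : ℝ) 1, ‖g x‖ := integral_nonneg fun x => norm_nonneg _
  have hfb : Integrable (fun x => f x • g x) unitVolume := by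
    obtain ⟨C, hC⟩ := isCompact_Icc.exists_bound_of_continuousOn (s := Icc (0 : ℝ) 1)
      hf.continuous.continuousOn
    refine (hg.norm.const_mul C).mono' (hf.continuous.aestronglyMeasurable.smul hg.1) ?_
    filter_upwards [ae_restrict_mem measurableSet_Ioo] with x hx
    rw [norm_smul]
    exact mul_le_mul_of_nonneg_right (hC x (Ioo_subset_Icc_self hx)) (norm_nonneg _)
  rw [← norm_le_zero_iff]
  refine le_of_forall_pos_le_add fun ε hε => ?_
  set K := ∫ x in Ioo (0 : ℝ) 1, ‖g x‖ with hKdef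
  -- By Weierstrass, test functions are uniformly close on `[0,1]` to polynomials, against which `g`
  -- integrates to `0`.
  obtain ⟨P, hP⟩ := exists_polynomial_near_of_continuousOn 0 1 f hf.continuous.continuousOn
    (ε / (K + 1)) (by positivity)
  calc ‖∫ x in Ioo (0 : ℝ) 1, f x • g x‖
      = ‖∫ x in Ioo (0 : ℝ) 1, (f x • g x - P.eval x • g x)‖ := by
        rw [integral_sub hfb (hpoly P).1, (hpoly P).2, sub_zero]
    _ ≤ ∫ x in Ioo (0 : ℝ) 1, ε / (K + 1) * ‖g x‖ := by
        refine norm_integral_le_of_norm_le (hg.norm.const_mul _) ?_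
        filter_upwards [ae_restrict_mem measurableSet_Ioo] with x hx
        rw [← sub_smul, norm_smul, norm_sub_rev]
        exact mul_le_mul_of_nonneg_right (hP x (Ioo_subset_Icc_self hx)).le (norm_nonneg _)
    _ = ε / (K + 1) * K := by rw [integral_const_mul]
    _ ≤ 0 + ε := by
        rw [zero_add, div_mul_eq_mul_div, div_le_iff₀ (by positivity)]
        nlinarith

end PowerFunctions

/-! ### The linear structure of `C_η` and the case `β = 0` -/

section NymanSpace

open Filter Topology

theorem kappa_of_lt_one (a : ℕ → ℂ) (α β : ℝ) {x : ℝ} (hx : x < 1) :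
    kappa a α β x = β * ((x ^ α : ℝ) : ℂ) := by
  rw [kappa, Nat.floor_eq_zero.2 hx]
  simp

/-- The space `C_η` as a subspace of `L^p(0,1)`. -/
def nymanSubmodule (a : ℕ → ℂ) (α β : ℝ) (p : ℝ≥0∞) : Submodule ℂ (Lp ℂ p unitVolume) where
  carrier := nymanSpaceLp a α β p
  zero_mem' := ⟨0, ⟨0, Fin.elim0, Fin.elim0, by simp⟩, Lp.coeFn_zero _ _ _⟩
  add_mem' := by
    rintro f₁ f₂ ⟨h₁, ⟨n₁, b₁, θ₁, hθ₁, hs₁, hx₁⟩, hf₁⟩ ⟨h₂, ⟨n₂, b₂, θ₂, hθ₂, hs₂, hx₂⟩, hf₂⟩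
    refine ⟨h₁ + h₂, ⟨n₁ + n₂, Fin.append b₁ b₂, Fin.append θ₁ θ₂, ?_, ?_, fun x hx => ?_⟩,
      (Lp.coeFn_add _ _).trans (hf₁.add hf₂)⟩
    · refine Fin.addCases (fun i => ?_) fun i => ?_
      · rw [Fin.append_left]
        exact hθ₁ i
      · rw [Fin.append_right]
        exact hθ₂ i
    · simp only [Fin.sum_univ_add, Fin.append_left, Fin.append_right, mul_add, hs₁, hs₂, add_zero]
    · simp only [Pi.add_apply, Fin.sum_univ_add, Fin.append_left, Fin.append_right, hx₁ x hx,
        hx₂ x hx]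
  smul_mem' := by
    rintro c f ⟨h, ⟨n, b, θ, hθ, hs, hx⟩, hf⟩
    refine ⟨c • h, ⟨n, fun k => c * b k, θ, hθ, ?_, fun x hx' => ?_⟩,
      (Lp.coeFn_smul _ _).trans (hf.const_smul c)⟩
    · simp only [mul_div_assoc, ← Finset.mul_sum]
      rw [mul_left_comm, hs, mul_zero]
    · simp only [Pi.smul_apply, smul_eq_mul, mul_assoc, ← Finset.mul_sum, hx x hx']

theorem nymanSpace_beta_zero (a : ℕ → ℂ) (α : ℝ) : nymanSpace a α 0 = nymanSpace a 0 0 := by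
  simp [nymanSpace, kappa]

theorem IsClassD.alpha_zero {a : ℕ → ℂ} {α : ℝ} (hD : IsClassD a α 0) : IsClassD a 0 0 where
  coeff_one_ne_zero := hD.coeff_one_ne_zero
  alpha_nonneg := le_rfl
  alpha_le_one := zero_le_one
  beta_eq_zero _ := rfl
  bounded := by simpa [kappa] using hD.bounded

end NymanSpace

/-! ### A zero of `η` keeps the constant function away from `C_η` -/

section ZerosObstruct

open Filter Topology

variable {a : ℕ → ℂ} {α β : ℝ}

/-- Split at `u = 1/θ`: below it the argument of `κ` exceeds `1` and the integral rescales to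
`θ^(-ρ)` times the tail transform; above it `κ` is the pure power `β (θu)^(-α)`. The linear
condition defining `C_η` is what cancels the term `β / θ^α`. -/
theorem IsClassD.sub_mul_setIntegral_kappa (hD : IsClassD a α β) {ρ : ℂ} (hρ : 0 < ρ.re)
    (hρα : ρ ≠ α) {θ : ℝ} (hθ : 1 ≤ θ) :
    (ρ - α) * ∫ u in Ioo (0 : ℝ) 1, (u : ℂ) ^ (ρ - 1) * kappa a α β (1 / (θ * u)) =
      β / ((θ ^ α : ℝ) : ℂ) + (θ : ℂ) ^ (-ρ) * mellinFactor (kappa a α β) β α ρ := by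
  obtain ⟨M, hM⟩ := hD.bounded
  have hθ0 : 0 < θ := one_pos.trans_le hθ
  set φ := (Ioi (1 : ℝ)).indicator (kappa a α β) with hφ
  have hconv : MellinConvergent φ (-ρ) :=
    mellinConvergent_indicator_Ioi_one (measurable_kappa a α β) hM hρ
  have hinv : MellinConvergent (fun t => φ t⁻¹) ρ := by
    have := MellinConvergent.comp_rpow (f := φ) (s := ρ) (a := -1) (by norm_num)
    simp only [Real.rpow_neg_one, Complex.ofReal_neg, Complex.ofReal_one, div_neg, div_one] at this
    exact this.2 hconv
  have hmul : MellinConvergent (fun u => φ (θ * u)⁻¹) ρ :=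
    (MellinConvergent.comp_mul_left (f := fun t => φ t⁻¹) hθ0).2 hinv
  have hval : mellin (fun u => φ (θ * u)⁻¹) ρ = (θ : ℂ) ^ (-ρ) * tailMellin (kappa a α β) ρ := by
    rw [mellin_comp_mul_left (fun t => φ t⁻¹) ρ hθ0, mellin_comp_inv, smul_eq_mul, tailMellin]
  have hθi : 0 < 1 / θ := by positivity
  have hθi1 : 1 / θ ≤ 1 := by rwa [div_le_one hθ0]
  have h0 : (0 : ℝ) ∉ uIcc (1 / θ) 1 := by
    rw [uIcc_of_le hθi1]
    exact fun h => absurd h.1 (not_le.2 hθi)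
  have hr : ρ - α - 1 ≠ -1 := by
    intro h
    apply hρα
    linear_combination h
  have hint : IntegrableOn (fun u : ℝ => (u : ℂ) ^ (ρ - α - 1)) (Ioc (1 / θ) 1) := by
    have := intervalIntegral.intervalIntegrable_cpow (μ := volume) (r := ρ - α - 1) (Or.inr h0)
    rwa [intervalIntegrable_iff, uIoc_of_le hθi1] at this
  have hvalint : ∫ u in Ioc (1 / θ) 1, (u : ℂ) ^ (ρ - α - 1) =
      (1 - (θ : ℂ) ^ (-ρ) * ((θ ^ α : ℝ) : ℂ)) / (ρ - α) := by
    rw [← intervalIntegral.integral_of_le hθi1, integral_cpow (Or.inr ⟨hr, h0⟩), sub_add_cancel,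
      Complex.ofReal_one, Complex.one_cpow, one_div, Complex.ofReal_inv,
      Complex.inv_cpow _ _ (by rw [Complex.arg_ofReal_of_nonneg hθ0.le]; exact Real.pi_pos.ne),
      ← Complex.cpow_neg, Complex.ofReal_cpow hθ0.le,
      ← Complex.cpow_add _ _ (Complex.ofReal_ne_zero.2 hθ0.ne')]
    congr 3
    ring
  set c : ℂ := β / ((θ ^ α : ℝ) : ℂ) with hc
  have hae : ∀ᵐ u : ℝ ∂(volume.restrict (Ioi (0 : ℝ))),
      (Ioo (0 : ℝ) 1).indicator (fun u => (u : ℂ) ^ (ρ - 1) * kappa a α β (1 / (θ * u))) u =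
      (u : ℂ) ^ (ρ - 1) • φ (θ * u)⁻¹ +
        (Ioc (1 / θ) 1).indicator (fun u : ℝ => c * (u : ℂ) ^ (ρ - α - 1)) u := by
    have hne : ∀ᵐ t : ℝ ∂(volume.restrict (Ioi (0 : ℝ))), t ≠ 1 :=
      ae_restrict_of_ae (Measure.ae_ne volume 1)
    have hne' : ∀ᵐ t : ℝ ∂(volume.restrict (Ioi (0 : ℝ))), t ≠ 1 / θ :=
      ae_restrict_of_ae (Measure.ae_ne volume (1 / θ))
    filter_upwards [hne, hne', ae_restrict_mem measurableSet_Ioi] with u hu hu' hu0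
    have hu0 : 0 < u := hu0
    rcases lt_or_gt_of_ne hu' with h | h
    · have h1 : 1 < (θ * u)⁻¹ := by
        rw [one_lt_inv₀ (by positivity)]
        rwa [lt_div_iff₀' hθ0] at h
      rw [indicator_of_mem (show u ∈ Ioo (0 : ℝ) 1 from ⟨hu0, h.trans_le hθi1⟩),
        indicator_of_notMem (fun h' : u ∈ Ioc (1 / θ) 1 => absurd h'.1 (not_lt.2 h.le)), hφ,
        indicator_of_mem (show (θ * u)⁻¹ ∈ Ioi (1 : ℝ) from h1), add_zero, smul_eq_mul, one_div]
    · have h1 : (θ * u)⁻¹ < 1 := by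
        rw [inv_lt_one₀ (by positivity)]
        rwa [div_lt_iff₀' hθ0] at h
      rw [hφ, indicator_of_notMem (show (θ * u)⁻¹ ∉ Ioi (1 : ℝ) from not_lt.2 h1.le), smul_zero,
        zero_add]
      rcases lt_or_gt_of_ne hu with h2 | h2
      · rw [indicator_of_mem (show u ∈ Ioo (0 : ℝ) 1 from ⟨hu0, h2⟩),
          indicator_of_mem (show u ∈ Ioc (1 / θ) 1 from ⟨h, h2.le⟩), one_div,
          kappa_of_lt_one _ _ _ h1, Real.inv_rpow (by positivity), Real.mul_rpow hθ0.le hu0.le,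
          show ρ - α - 1 = (ρ - 1) - α by ring,
          Complex.cpow_sub (ρ - 1) _ (Complex.ofReal_ne_zero.2 hu0.ne'), hc,
          ← Complex.ofReal_cpow hu0.le]
        have := (Real.rpow_pos_of_pos hu0 α).ne'
        have := (Real.rpow_pos_of_pos hθ0 α).ne'
        push_cast
        field_simp
      · rw [indicator_of_notMem (fun h' : u ∈ Ioo (0 : ℝ) 1 => absurd h'.2 (not_lt.2 h2.le)),
          indicator_of_notMem (fun h' : u ∈ Ioc (1 / θ) 1 => absurd h'.2 (not_le.2 h2))]
  have e1 : ∫ u in Ioo (0 : ℝ) 1, (u : ℂ) ^ (ρ - 1) * kappa a α β (1 / (θ * u)) =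
      (θ : ℂ) ^ (-ρ) * tailMellin (kappa a α β) ρ +
        c * ((1 - (θ : ℂ) ^ (-ρ) * ((θ ^ α : ℝ) : ℂ)) / (ρ - α)) := by
    have hs1 : Ioi (0 : ℝ) ∩ Ioo 0 1 = Ioo 0 1 := inter_eq_right.2 fun x hx => hx.1
    have hs2 : Ioi (0 : ℝ) ∩ Ioc (1 / θ) 1 = Ioc (1 / θ) 1 :=
      inter_eq_right.2 fun x hx => hθi.trans hx.1
    have h1 : ∫ u in Ioi (0 : ℝ), (Ioc (1 / θ) 1).indicator
        (fun u : ℝ => c * (u : ℂ) ^ (ρ - α - 1)) u =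
        c * ((1 - (θ : ℂ) ^ (-ρ) * ((θ ^ α : ℝ) : ℂ)) / (ρ - α)) := by
      rw [setIntegral_indicator measurableSet_Ioc, hs2, integral_const_mul, hvalint]
    rw [← hval, mellin, ← h1, ← integral_add hmul
      ((IntegrableOn.integrable_indicator (hint.const_mul c) measurableSet_Ioc).integrableOn),
      ← integral_congr_ae hae, setIntegral_indicator measurableSet_Ioo, hs1]
  have hne : ρ - α ≠ 0 := sub_ne_zero.2 hρα
  have hne2 : ((θ ^ α : ℝ) : ℂ) ≠ 0 := Complex.ofReal_ne_zero.2 (Real.rpow_pos_of_pos hθ0 α).ne'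
  rw [e1, mellinFactor, hc]
  field_simp
  ring

theorem IsClassD.indicatorConstLp_notMem_closure (hD : IsClassD a α β) (hβ : β = 0 → α = 0)
    {p : ℝ≥0∞} [Fact (1 ≤ p)] (hp1 : 1 < p) (hp : p ≠ ∞) {ρ : ℂ} (hρ : 1 / p.toReal < ρ.re)
    (hB : mellinFactor (kappa a α β) β α ρ = 0) :
    indicatorConstLp p (measurableSet_Icc : MeasurableSet (Icc (0 : ℝ) 1))
      (measure_ne_top unitVolume _) (1 : ℂ) ∉ closure (nymanSpaceLp a α β p) := by
  have hp1' : 1 < p.toReal := by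
    rwa [← ENNReal.toReal_one, ENNReal.toReal_lt_toReal ENNReal.one_ne_top hp]
  have hρ0 : 0 < ρ.re := lt_trans (by positivity) hρ
  have hρne : ρ ≠ 0 := by
    rintro rfl
    simp at hρ0
  have hρα : ρ ≠ α := by
    intro h
    rw [mellinFactor, h, sub_self, zero_mul, zero_sub, neg_eq_zero, Complex.ofReal_eq_zero] at hB
    rw [hβ hB, Complex.ofReal_zero] at h
    exact hρne h
  obtain ⟨M, hM⟩ := hD.bounded
  set q : ℝ≥0∞ := ENNReal.conjExponent p with hq
  have hpq : p.toReal.HolderConjugate q.toReal := ENNReal.HolderConjugate.toReal hp1'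
  have hq0 : q ≠ 0 := fun h => hpq.symm.ne_zero (by rw [h, ENNReal.toReal_zero])
  have hqt : q ≠ ∞ := fun h => hpq.symm.ne_zero (by rw [h, ENNReal.toReal_top])
  have : ENNReal.HolderConjugate q p := ENNReal.HolderConjugate.symm
  have : Fact (1 ≤ q) := ⟨ENNReal.HolderConjugate.one_le q p⟩
  have hr : -1 < (ρ - 1).re * q.toReal := by
    have h1 := hpq.inv_add_inv_eq_one
    have h2 := hpq.symm.pos
    rw [one_div] at hρ
    -- The line `Re ρ = 1/p` is exactly the threshold for `u ^ (ρ - 1)` to be in `L^q(0,1)`.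
    have h3 : (p.toReal⁻¹ - 1) * q.toReal = -1 := by
      rw [show p.toReal⁻¹ - 1 = -(q.toReal)⁻¹ by linarith, neg_mul, inv_mul_cancel₀ h2.ne']
    rw [← h3, Complex.sub_re, Complex.one_re]
    gcongr
  have hmem := memLp_ofReal_cpow hq0 hqt hr
  set L : Lp ℂ p unitVolume →L[ℂ] ℂ :=
    ContinuousLinearMap.lpPairing unitVolume q p (ContinuousLinearMap.mul ℂ ℂ) (hmem.toLp _)
    with hL
  have hLval : ∀ (f : Lp ℂ p unitVolume) (h : ℝ → ℂ), f =ᵐ[unitVolume] h →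
      L f = ∫ u in Ioo (0 : ℝ) 1, (u : ℂ) ^ (ρ - 1) * h u := by
    intro f h hfh
    rw [hL, ContinuousLinearMap.lpPairing_eq_integral]
    refine integral_congr_ae ?_
    filter_upwards [hmem.coeFn_toLp, hfh] with u h1 h2
    rw [h1, h2, ContinuousLinearMap.mul_apply']
  have hker : nymanSpaceLp a α β p ⊆ {f | L f = 0} := by
    rintro f ⟨h, ⟨n, b, θ, hθ, hs, hx⟩, hf⟩
    have hmem1 : IntegrableOn (fun u : ℝ => (u : ℂ) ^ (ρ - 1)) (Ioo 0 1) :=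
      hmem.integrable Fact.out
    have hint : ∀ k, IntegrableOn
        (fun u : ℝ => (u : ℂ) ^ (ρ - 1) * kappa a α β (1 / (θ k * u))) (Ioo 0 1) := by
      intro k
      refine (hmem1.norm.mul_const M).mono' (hmem1.1.mul
        ((measurable_kappa a α β).comp (by fun_prop)).aestronglyMeasurable) ?_
      filter_upwards [ae_restrict_mem measurableSet_Ioo] with u hu
      rw [norm_mul]
      refine mul_le_mul_of_nonneg_left (hM _ ?_) (norm_nonneg _)
      have := hθ k
      have := hu.1
      positivity
    have e1 : L f = ∑ k, b k * ∫ u in Ioo (0 : ℝ) 1,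
        (u : ℂ) ^ (ρ - 1) * kappa a α β (1 / (θ k * u)) := by
      rw [hLval f h hf]
      simp_rw [← integral_const_mul]
      rw [← integral_finsetSum _ fun k _ => (hint k).const_mul (b k)]
      refine setIntegral_congr_fun measurableSet_Ioo fun u hu => ?_
      rw [hx u hu, Finset.mul_sum]
      exact Finset.sum_congr rfl fun k _ => by ring
    have e2 : (ρ - α) * L f = 0 := by
      rw [e1, Finset.mul_sum, ← hs, Finset.mul_sum]
      refine Finset.sum_congr rfl fun k _ => ?_
      rw [mul_left_comm, hD.sub_mul_setIntegral_kappa hρ0 hρα (hθ k), hB]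
      ring
    exact (mul_eq_zero.1 e2).resolve_left (sub_ne_zero.2 hρα)
  intro hcl
  have h0 := closure_minimal hker (isClosed_eq L.continuous continuous_const) hcl
  have h1 : L (indicatorConstLp p (measurableSet_Icc : MeasurableSet (Icc (0 : ℝ) 1))
      (measure_ne_top unitVolume _) (1 : ℂ)) = 1 / ρ := by
    rw [hLval _ _ indicatorConstLp_coeFn]
    have h2 : ∀ u ∈ Ioo (0 : ℝ) 1,
        (u : ℂ) ^ (ρ - 1) * (Icc (0 : ℝ) 1).indicator (fun _ => (1 : ℂ)) u = (u : ℂ) ^ (ρ - 1) := by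
      intro u hu
      rw [indicator_of_mem (Ioo_subset_Icc_self hu), mul_one]
    rw [setIntegral_congr_fun measurableSet_Ioo h2, ← integral_Ioc_eq_integral_Ioo,
      ← intervalIntegral.integral_of_le zero_le_one, integral_cpow (Or.inl (by simpa using hρ0)),
      sub_add_cancel, Complex.ofReal_one, Complex.one_cpow, Complex.ofReal_zero,
      Complex.zero_cpow hρne, sub_zero]
  exact one_div_ne_zero hρne (h1.symm.trans h0)

end ZerosObstruct

/-! ### Absence of zeros implies density -/

section Density

open Filter Topology

/-- A subspace on which only the zero functional vanishes is dense. -/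
theorem Submodule.closure_eq_univ_of_dual {E : Type*} [NormedAddCommGroup E] [NormedSpace ℂ E]
    (S : Submodule ℂ E) (h : ∀ Λ : E →L[ℂ] ℂ, (∀ f ∈ S, Λ f = 0) → Λ = 0) :
    closure (S : Set E) = univ := by
  by_contra hne
  obtain ⟨x, hx⟩ := (ne_univ_iff_exists_notMem _).1 hne
  have hconv : Convex ℝ (closure (S : Set E)) := (S.restrictScalars ℝ).convex.closure
  obtain ⟨Λ, u, hu, hux⟩ := RCLike.geometric_hahn_banach_closed_point (𝕜 := ℂ) hconv
    isClosed_closure hx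
  have hu0 : 0 < u := by simpa using hu 0 (subset_closure S.zero_mem)
  have hz : ∀ f ∈ S, Λ f = 0 := by
    intro f hf
    by_contra hne
    -- Rescaling `f` makes `Λ` take the value `u` on the subspace, contrary to the strict
    -- separation.
    have := hu _ (subset_closure (S.smul_mem ((u : ℂ) / Λ f) hf))
    rw [map_smul, smul_eq_mul, div_mul_cancel₀ _ hne] at this
    exact absurd this (by simp)
  rw [h Λ hz] at hux
  exact absurd hux (by simpa using hu0.le)

variable {a : ℕ → ℂ} {α β : ℝ} {p : ℝ≥0∞} [Fact (1 ≤ p)]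

/-- The multiplicative convolution of `κ` with `g` over `(0,1)`. -/
noncomputable def kappaConv (a : ℕ → ℂ) (α β : ℝ) (g : ℝ → ℂ) (l : ℝ) : ℂ :=
  ∫ x in Ioo (0 : ℝ) 1, kappa a α β (l / x) * g x

theorem measurable_kappaConv (a : ℕ → ℂ) (α β : ℝ) {g : ℝ → ℂ} (hg : Measurable g) :
    Measurable (kappaConv a α β g) := by
  have h1 : Measurable fun z : ℝ × ℝ => kappa a α β (z.1 / z.2) * g z.2 :=
    ((measurable_kappa a α β).comp (by fun_prop)).mul (by fun_prop)
  exact (h1.stronglyMeasurable.integral_prod_right (ν := unitVolume)).measurable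

theorem norm_kappaConv_le {M : ℝ} (hM : ∀ x, 0 < x → ‖kappa a α β x‖ ≤ M) {g : ℝ → ℂ}
    (hg : Integrable g unitVolume) {l : ℝ} (hl : 0 < l) :
    ‖kappaConv a α β g l‖ ≤ M * ∫ x in Ioo (0 : ℝ) 1, ‖g x‖ := by
  rw [kappaConv, ← integral_const_mul]
  refine norm_integral_le_of_norm_le (hg.norm.const_mul _) ?_
  filter_upwards [ae_restrict_mem measurableSet_Ioo] with x hx
  rw [norm_mul]
  exact mul_le_mul_of_nonneg_right (hM _ (div_pos hl hx.1)) (norm_nonneg _)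

theorem IsClassD.sum_mul_kappaConv_eq_zero (hD : IsClassD a α β) (hp : p ≠ ∞)
    {Λ : Lp ℂ p unitVolume →L[ℂ] ℂ} {g : ℝ → ℂ} (hΛ : RepresentsOnSets Λ g)
    (hg : Integrable g unitVolume) (hΛ0 : ∀ f ∈ nymanSpaceLp a α β p, Λ f = 0)
    {n : ℕ} (b : Fin n → ℂ) (θ : Fin n → ℝ) (hθ : ∀ k, 1 ≤ θ k)
    (hs : (β : ℂ) * ∑ k, b k / ((θ k ^ α : ℝ) : ℂ) = 0) :
    ∑ k, b k * kappaConv a α β g (1 / θ k) = 0 := by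
  obtain ⟨M, hM⟩ := hD.bounded
  have hM0 : 0 ≤ M := (norm_nonneg _).trans (hM 1 one_pos)
  set h : ℝ → ℂ := (Ioo (0 : ℝ) 1).indicator
    fun x => ∑ k, b k * kappa a α β (1 / (θ k * x)) with hh
  have hmem : h ∈ nymanSpace a α β :=
    ⟨n, b, θ, hθ, hs, fun x hx => by rw [hh, indicator_of_mem hx]⟩
  have hLp := memLp_of_mem_nymanSpace hD p hmem
  have hmeas : Measurable h := by
    refine Measurable.indicator ?_ measurableSet_Ioo
    refine Finset.measurable_fun_sum _ fun k _ => ?_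
    exact ((measurable_kappa a α β).comp (by fun_prop)).const_mul _
  have hpos : ∀ k, ∀ x ∈ Ioo (0 : ℝ) 1, 0 < 1 / (θ k * x) := fun k x hx => by
    have := hθ k
    have := hx.1
    positivity
  have hbd : ∀ x, ‖h x‖ ≤ ∑ k, ‖b k‖ * M := by
    intro x
    by_cases hx : x ∈ Ioo (0 : ℝ) 1
    · rw [hh, indicator_of_mem hx]
      refine norm_sum_le_of_le _ fun k _ => ?_
      rw [norm_mul]
      exact mul_le_mul_of_nonneg_left (hM _ (hpos k x hx)) (norm_nonneg _)
    · rw [hh, indicator_of_notMem hx, norm_zero]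
      positivity
  have h1 := hΛ.apply_of_bound hp hg hmeas hbd hLp
  rw [hΛ0 _ ⟨h, hmem, hLp.coeFn_toLp⟩] at h1
  rw [h1]
  have hint : ∀ k, IntegrableOn (fun x => kappa a α β (1 / θ k / x) * g x) (Ioo 0 1) := by
    intro k
    refine (hg.norm.const_mul M).mono' (((measurable_kappa a α β).comp
      (by fun_prop)).aestronglyMeasurable.mul hg.1) ?_
    filter_upwards [ae_restrict_mem measurableSet_Ioo] with x hx
    rw [norm_mul, div_div]
    exact mul_le_mul_of_nonneg_right (hM _ (hpos k x hx)) (norm_nonneg _)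
  simp_rw [kappaConv, ← integral_const_mul]
  rw [← integral_finsetSum _ fun k _ => (hint k).const_mul (b k)]
  refine setIntegral_congr_fun measurableSet_Ioo fun x hx => ?_
  simp only [hh, indicator_of_mem hx, Finset.sum_mul, div_div, mul_assoc]

/-- Each `l < 1` is `1 / θ` with an admissible `θ`. For `β = 0` a single dilate already lies in
`C_η`; otherwise it is corrected by `-l^α` times the dilate `θ = 1`, which leaves the constant `C =
c(1)`. -/
theorem IsClassD.exists_kappaConv_eq (hD : IsClassD a α β) (hp : p ≠ ∞)
    {Λ : Lp ℂ p unitVolume →L[ℂ] ℂ} {g : ℝ → ℂ} (hΛ : RepresentsOnSets Λ g)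
    (hg : Integrable g unitVolume) (hΛ0 : ∀ f ∈ nymanSpaceLp a α β p, Λ f = 0) :
    ∃ C : ℂ, (β = 0 → C = 0) ∧
      ∀ l : ℝ, 0 < l → l < 1 → kappaConv a α β g l = C * ((l ^ α : ℝ) : ℂ) := by
  by_cases hβ : β = 0
  · refine ⟨0, fun _ => rfl, fun l hl hl1 => ?_⟩
    have h := hD.sum_mul_kappaConv_eq_zero hp hΛ hg hΛ0 (n := 1) (fun _ => 1) (fun _ => 1 / l)
      (fun _ => (one_le_div hl).2 hl1.le) (by simp [hβ])
    simpa using h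
  · refine ⟨kappaConv a α β g 1, fun h => absurd h hβ, fun l hl hl1 => ?_⟩
    have hl' : ((l ^ α : ℝ) : ℂ) ≠ 0 := Complex.ofReal_ne_zero.2 (Real.rpow_pos_of_pos hl α).ne'
    have h := hD.sum_mul_kappaConv_eq_zero hp hΛ hg hΛ0 (n := 2) ![1, -((l ^ α : ℝ) : ℂ)]
      ![1 / l, 1] (by
        rw [Fin.forall_fin_two]
        exact ⟨(one_le_div hl).2 hl1.le, le_rfl⟩) (by
        rw [Fin.sum_univ_two]
        simp [Real.inv_rpow hl.le])
    rw [Fin.sum_univ_two] at h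
    simp only [Matrix.cons_val_zero, Matrix.cons_val_one, one_div_one_div, one_mul, div_one] at h
    linear_combination h

theorem IsClassD.dual_eq_zero (hD : IsClassD a α β) (hp1 : 1 < p) (hp : p ≠ ∞)
    (hB0 : ∀ s : ℂ, 1 / p.toReal < s.re → mellinFactor (kappa a α β) β α s ≠ 0)
    {Λ : Lp ℂ p unitVolume →L[ℂ] ℂ} (hΛ0 : ∀ f ∈ nymanSpaceLp a α β p, Λ f = 0) : Λ = 0 := by
  have hp1' : 1 < p.toReal := by
    rwa [← ENNReal.toReal_one, ENNReal.toReal_lt_toReal ENNReal.one_ne_top hp]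
  have hp0 : p ≠ 0 := (zero_lt_one.trans hp1).ne'
  obtain ⟨g, hgm, hg, hΛ⟩ := exists_integrable_setIntegral_eq hp Λ
  have hΛ : RepresentsOnSets Λ g := hΛ
  obtain ⟨M, hM⟩ := hD.bounded
  obtain ⟨C, hCβ, hC⟩ := hD.exists_kappaConv_eq hp hΛ hg hΛ0
  set P := p.toReal with hP
  set σ := 1 / P with hσ
  have hP0 : 0 < P := one_pos.trans hp1'
  have hσ0 : 0 < σ := by positivity
  have hσ1 : σ < 1 := by rwa [hσ, div_lt_one hP0]
  have hr : ∀ w : ℂ, w.re < σ → -1 < (-w).re * P := by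
    intro w hw
    rw [hσ, lt_div_iff₀ hP0] at hw
    rw [Complex.neg_re]
    linarith
  have hGi : ∀ w : ℂ, w.re < σ → Integrable (fun x : ℝ => (x : ℂ) ^ (-w) * g x) unitVolume ∧
      ∫ x in Ioo (0 : ℝ) 1, ‖(x : ℂ) ^ (-w) * g x‖ ≤
        ‖Λ‖ * P ^ (-σ) * (σ - w.re) ^ (-σ) := by
    intro w hw
    have h1 := hΛ.integrable_mul hp hg hgm (measurable_ofReal_cpow_const (-w))
      (memLp_ofReal_cpow hp0 hp (hr w hw))
    refine ⟨h1.1, h1.2.trans (le_of_eq ?_)⟩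
    rw [eLpNorm_ofReal_cpow hp0 hp (hr w hw), mul_assoc, ← hP, ← one_div P, ← hσ,
      ← Real.mul_rpow hP0.le (by linarith), one_div, Real.inv_rpow, ← Real.rpow_neg]
    · congr 2
      rw [Complex.neg_re, hσ]
      field_simp
      ring
    · have := hr w hw
      linarith
    · have := hr w hw
      linarith
  set G : ℂ → ℂ := fun w => ∫ x in Ioo (0 : ℝ) 1, (x : ℂ) ^ (-w) * g x with hG
  set c := kappaConv a α β g with hc
  have hcm : Measurable c := measurable_kappaConv a α β hgm
  have hcM : ∀ l, 0 < l → ‖c l‖ ≤ M * ∫ x in Ioo (0 : ℝ) 1, ‖g x‖ := fun l hl =>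
    norm_kappaConv_le hM hg hl
  obtain ⟨c₀, σ₀, hc₀, hBc⟩ := hD.exists_norm_mellinFactor_ge
  -- In the strip `0 < Re w < δ` the transforms of `κ`, of `c` and of `g` all converge; for `β ≠ 0`
  -- convergence of the first two at `0` requires `Re w < α`, and `α > 0` then holds.
  obtain ⟨δ, hδ0, hδσ, hδα⟩ : ∃ δ : ℝ, 0 < δ ∧ δ ≤ σ ∧ (β ≠ 0 → δ ≤ α) := by
    by_cases hβ : β = 0
    · exact ⟨σ, hσ0, le_rfl, fun h => absurd hβ h⟩
    · have hα : 0 < α := lt_of_le_of_ne hD.alpha_nonneg fun h => hβ (hD.beta_eq_zero h.symm)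
      exact ⟨min α σ, lt_min hα hσ0, min_le_right _ _, fun _ => min_le_left _ _⟩
  have hmul : ∀ w : ℂ, 0 < w.re → w.re < δ →
      G w * mellinFactor (kappa a α β) β α w = mellinFactor c C α w := by
    intro w hw0 hwδ
    have h1 := hasMellin_neg_of_eq_rpow (measurable_kappa a α β) hM (b := β)
      (fun x _ hx1 => kappa_of_lt_one a α β hx1) hw0 (by
        by_cases hβ : β = 0
        · exact Or.inl (by simp [hβ])
        · exact Or.inr (hwδ.trans_le (hδα hβ)))
    have h2 := hasMellin_neg_of_eq_rpow hcm hcM hC hw0 (by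
        by_cases hβ : β = 0
        · exact Or.inl (hCβ hβ)
        · exact Or.inr (hwδ.trans_le (hδα hβ)))
    have h3 := mellin_setIntegral_comp_div (measurable_kappa a α β) hgm h1.1
      (hGi w (hwδ.trans_le hδσ)).1
    have h4 : mellin c (-w) = G w * mellin (kappa a α β) (-w) := h3
    rw [← h1.2, ← h2.2, h4]
    ring
  obtain ⟨K, hK1, hK2⟩ : ∃ K : ℝ,
      (∀ w : ℂ, σ < w.re → ‖mellinFactor (kappa a α β) β α w‖ ≤ K * (1 + ‖w‖)) ∧
      ∀ w : ℂ, σ < w.re → ‖mellinFactor c C α w‖ ≤ K * (1 + ‖w‖) :=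
    ⟨max _ _, fun w hw => (norm_mellinFactor_le hM β hσ0 hw).trans
      (mul_le_mul_of_nonneg_right (le_max_left _ _) (by positivity)),
      fun w hw => (norm_mellinFactor_le hcM C hσ0 hw).trans
      (mul_le_mul_of_nonneg_right (le_max_right _ _) (by positivity))⟩
  have hGd : DifferentiableOn ℂ G {w | w.re < σ} := by
    refine differentiableOn_setIntegral_cpow hgm fun τ hτ => ?_
    refine (hGi τ (by simpa using hτ)).1.norm.congr ?_
    filter_upwards [ae_restrict_mem measurableSet_Ioo] with x hx
    rw [norm_mul, Complex.norm_cpow_eq_rpow_re_of_pos hx.1]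
    simp
  have hG0 := eq_zero_of_mul_eq hσ0 hσ1 hδ0 hδσ hc₀ hGd
    (differentiableOn_mellinFactor (measurable_kappa a α β) hM β α)
    (differentiableOn_mellinFactor hcm hcM C α)
    (fun w hw => (norm_integral_le_integral_norm _).trans (hGi w hw).2) hmul hK1 hK2 hB0 hBc
  have hg0 : ∀ᵐ x ∂unitVolume, g x = 0 := by
    refine ae_eq_zero_of_moments_eq_zero hg fun n => ?_
    -- At `w = -n` the transform `G` is the `n`-th moment of `g`.
    have := hG0 (-(n : ℂ)) (by
      simp only [Complex.neg_re, Complex.natCast_re]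
      linarith [Nat.cast_nonneg (α := ℝ) n])
    simpa [hG] using this
  refine RepresentsOnSets.eq_zero hp fun E hE => ?_
  rw [hΛ E hE]
  refine integral_congr_ae ?_
  exact ae_restrict_of_ae hg0

theorem IsClassD.tfae (hD : IsClassD a α β) (hβ : β = 0 → α = 0) {F : ℂ → ℂ}
    (hF : IsDirichletContinuation a F) (hp1 : 1 < p) (hp : p ≠ ∞) :
    List.TFAE [
      NoZerosRightOf F (1 / p.toReal),
      closure (nymanSpaceLp a α β p) = univ,
      indicatorConstLp p (measurableSet_Icc : MeasurableSet (Icc (0 : ℝ) 1))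
        (measure_ne_top unitVolume _) (1 : ℂ) ∈ closure (nymanSpaceLp a α β p)] := by
  have hp0 : 0 ≤ 1 / p.toReal := by positivity
  tfae_have 1 → 2 := fun h =>
    (nymanSubmodule a α β p).closure_eq_univ_of_dual fun Λ hΛ => hD.dual_eq_zero hp1 hp
      (fun s hs hB => not_lt.2 (h s hs)
        ((hF.meromorphicOrderAt_pos_iff hD hβ (hp0.trans_lt hs)).2 hB)) hΛ
  tfae_have 2 → 3 := fun h => h ▸ mem_univ _
  tfae_have 3 → 1 := fun h s hs => not_lt.1 fun hpos =>
    hD.indicatorConstLp_notMem_closure hβ hp1 hp hs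
      ((hF.meromorphicOrderAt_pos_iff hD hβ (hp0.trans_lt hs)).1 hpos) h
  tfae_finish

end Density

theorem mainTheorem4 (a : ℕ → ℂ) (α β : ℝ) (hD : IsClassD a α β) :
    (∃ F : ℂ → ℂ, IsDirichletContinuation a F) ∧
    ∀ F : ℂ → ℂ, IsDirichletContinuation a F →
      ∀ (p : ℝ≥0∞) [Fact (1 ≤ p)], 1 < p → p ≠ ∞ →
        List.TFAE [
          NoZerosRightOf F (1 / p.toReal),
          closure (nymanSpaceLp a α β p) = univ,
          indicatorConstLp p (measurableSet_Icc : MeasurableSet (Icc (0 : ℝ) 1))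
            (measure_ne_top unitVolume _) (1 : ℂ) ∈ closure (nymanSpaceLp a α β p)] := by
  refine ⟨⟨_, hD.isDirichletContinuation⟩, fun F hF p _ hp1 hp => ?_⟩
  -- For `β = 0` neither `κ` nor `C_η` depends on `α`, which may be replaced by `0`; this secures
  -- the normalisation `β = 0 → α = 0`.
  by_cases hβ : β = 0
  · subst hβ
    have h : nymanSpaceLp a α 0 p = nymanSpaceLp a 0 0 p := by
      rw [nymanSpaceLp, nymanSpaceLp, nymanSpace_beta_zero]
    rw [h]
    exact hD.alpha_zero.tfae (fun _ => rfl) hF hp1 hp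
  · exact hD.tfae (fun h => absurd h hβ) hF hp1 hp
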